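/- Let $\widehat G$ be a finite weighted directed graph with $m+n$ vertices ($m,n\ge 0$), with complex edge weights $w_{uv}$ satisfying $w_{vu}=\overline{w_{uv}}$ (loops allowed). Distinguish $n$ of its vertices, call them $(1,1),\dots,(1,n)$, and attach to each $(1,j)$ a semi-infinite path with vertices $(1,j),(2,j),(3,j),\dots$; the other $m$ vertices are called internal. Let $\widehat H=\sum_{u,v}w_{uv}|v\rangle\langle u|=\begin{pmatrix}A&B^\dagger\\ B&D\end{pmatrix}$, with $A$ of size $n\times n$ (distinguished vertices) and $D$ of size $m\times m$ (internal vertices), and let $H$ be the Hamiltonian of the infinite graph, $\widehat H$ plus $\sum_{j=1}^n\sum_{x\ge1}\big(|x,j\rangle\langle x+1,j|+|x+1,j\rangle\langle x,j|\big)$. Put $$\gamma(z)=\begin{pmatrix}zA-1&zB^\dagger\\ zB&zD-z^2-1\end{pmatrix}.$$ For a state $\psi$ (a complex amplitude function on the vertices of the infinite graph) let $\widehat\psi\in\mathbb C^{n+m}$ be its restriction to the vertices of $\widehat G$. For $z\in\mathbb C$ let $E_z$ be the space of the states with $\langle x,j|\psi\rangle=\alpha_jz^{x-1}$ on the paths for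 some $\alpha\in\mathbb C^n$, and with $\gamma(z)\widehat\psi=0$; for $z\neq0$ these are the eigenstates of $H$ of this form with energy $z+1/z$. Let $\mathcal C_>$, $\mathcal C_<$, $\mathcal C_=$ be the spans of the states $\psi$ that vanish on all the paths and satisfy $\gamma(z)\widehat\psi=0$ for some $z$ with, respectively, $|z|<1$; $|z|=1$ and $z\ne\pm1$; $z\in\{1,-1\}$. Define the number of confined bound states, of unconfined bound states and of half-bound states by $$n_c=\dim(\mathcal C_>+\mathcal C_<+\mathcal C_=),\qquad n_b=\sum_{\substack{x\in(-1,1)\\ \det\gamma(x)=0}}\dim\big(E_x\cap\mathcal C_>^\perp\big),\qquad n_h=\sum_{x=\pm1}\dim\big(E_x\cap\mathcal C_=^\perp\big).$$ Let $S(z)$ be the upper left $n\times n$ block of $-\gamma(z)^{-1}\gamma(1/z)$, an $n\times n$ matrix of rational functions of $z$. **Theorem (Levinson's theorem for graphs).** 1. $S$ is the analytic continuation of the S-matrix: for every $k\in(-\pi,0)$ such that $\det\gamma(z)\ne0$ at $z=e^{ik}$, $S(z)$ is the unique $n\times n$ matrix $S_0$ such that for each $j\in\{1,\dots,n\}$ there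 is a state $|\mathrm{sc}_j(k)\rangle$ with $H|\mathrm{sc}_j(k)\rangle=(z+1/z)|\mathrm{sc}_j(k)\rangle$ and $\langle x,j'|\mathrm{sc}_j(k)\rangle=z^{-x}\delta_{j'j}+z^{x}(S_0)_{j'j}$ for all $j'\in\{1,\dots,n\}$ and $x\ge1$. 2. The rational function $\det S$ has no zeros and no poles on the unit circle $\Gamma$, and its winding number around $0$ along the positively oriented circle $\Gamma$ is $$w_\Gamma(\det S)=2\Big(m-n_b-n_c-\tfrac12n_h\Big).$$ -/

import Mathlib

open scoped Matrix ComplexConjugate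

/-- A finite weighted graph with `n + m` vertices: the `n` vertices `Sum.inl j`, to each of which
a semi-infinite path is attached, and the `m` internal vertices `Sum.inr i`. The edge `u → v`
carries the complex weight `weight u v` (zero if there is no edge), with `w v u = conj (w u v)`. -/
structure ScatteringGraph (n m : ℕ) where
  weight : Fin n ⊕ Fin m → Fin n ⊕ Fin m → ℂ
  weight_symm : ∀ u v, weight v u = conj (weight u v)

/-- The vertices of the infinite graph: `path x j` is the vertex `(x + 1, j)`, that is the one at
distance `x` from the attachment vertex `path 0 j`, which belongs to the finite graph. -/
inductive PathVertex (n m : ℕ) : Type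
  | path (x : ℕ) (j : Fin n) : PathVertex n m
  | internal (i : Fin m) : PathVertex n m

/-- States: arbitrary amplitude functions on the vertices of the infinite graph (half-bound states
and scattering states are not normalizable). -/
abbrev GraphState (n m : ℕ) : Type := PathVertex n m → ℂ

/-- Restriction of a state to the vertices of the finite graph. -/
def GraphState.hat {n m : ℕ} (ψ : GraphState n m) : Fin n ⊕ Fin m → ℂ :=
  Sum.elim (fun j => ψ (.path 0 j)) (fun i => ψ (.internal i))

namespace ScatteringGraph

noncomputable section

variable {n m : ℕ} (G : ScatteringGraph n m)

/-- The matrix of `∑ u v, w u v |v⟩⟨u|` in the vertex basis of the finite graph. -/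
def hamHat : Matrix (Fin n ⊕ Fin m) (Fin n ⊕ Fin m) ℂ := Matrix.of fun v u => G.weight u v

/-- The full Hamiltonian: the finite graph's Hamiltonian plus the adjacency operator of the
semi-infinite paths. -/
def ham (ψ : GraphState n m) : GraphState n m
  | .path 0 j => (G.hamHat *ᵥ ψ.hat) (Sum.inl j) + ψ (.path 1 j)
  | .path (x + 1) j => ψ (.path x j) + ψ (.path (x + 2) j)
  | .internal i => (G.hamHat *ᵥ ψ.hat) (Sum.inr i)

/-- The blocks of `hamHat = [[A, Bᴴ], [B, D]]`. -/
def blockA : Matrix (Fin n) (Fin n) ℂ := G.hamHat.toBlocks₁₁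

def blockB : Matrix (Fin m) (Fin n) ℂ := G.hamHat.toBlocks₂₁

def blockD : Matrix (Fin m) (Fin m) ℂ := G.hamHat.toBlocks₂₂

/-- `γ(z) = [[z A - 1, z Bᴴ], [z B, z D - z² - 1]]`, at an element `z` of any commutative
`ℂ`-algebra `R`: both at complex numbers and at the variable of the field of rational functions. -/
def gamma {R : Type} [CommRing R] [Algebra ℂ R] (z : R) :
    Matrix (Fin n ⊕ Fin m) (Fin n ⊕ Fin m) R :=
  Matrix.fromBlocks
    (z • G.blockA.map (algebraMap ℂ R) - 1)
    (z • (G.blockBᴴ).map (algebraMap ℂ R))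
    (z • G.blockB.map (algebraMap ℂ R))
    (z • G.blockD.map (algebraMap ℂ R) - z ^ 2 • (1 : Matrix (Fin m) (Fin m) R) - 1)

/-- The S-matrix, as a matrix of rational functions of `z`: the upper left `n × n` block of
`-γ(z)⁻¹ γ(1/z)`. -/
def sMatrix : Matrix (Fin n) (Fin n) (RatFunc ℂ) :=
  (-((G.gamma (RatFunc.X : RatFunc ℂ))⁻¹ * G.gamma ((RatFunc.X : RatFunc ℂ)⁻¹))).toBlocks₁₁

/-- `S₀` is a matrix of scattering amplitudes at `z`: for every path `j` there is an eigenstate of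
the Hamiltonian, of energy `z + 1/z`, whose amplitude at the vertex `(x, j')`, `x ≥ 1`, is
`z^{-x} δ_{j'j} + z^x S₀_{j'j}`. -/
def IsScatteringMatrix (z : ℂ) (S₀ : Matrix (Fin n) (Fin n) ℂ) : Prop :=
  ∀ j : Fin n, ∃ sc : GraphState n m,
    (∀ (x : ℕ) (j' : Fin n), sc (.path x j') =
      (z⁻¹) ^ (x + 1) * (if j' = j then 1 else 0) + z ^ (x + 1) * S₀ j' j) ∧
    G.ham sc = (z + z⁻¹) • sc

/-- The states `ψ` that have the form `⟨x, j|ψ⟩ = α_j z^{x-1}` on the paths and satisfy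
`γ(z) ψ̂ = 0`. -/
def solutionSpace (z : ℂ) : Submodule ℂ (GraphState n m) where
  carrier := {ψ | (∀ x j, ψ (.path x j) = ψ (.path 0 j) * z ^ x) ∧ G.gamma z *ᵥ ψ.hat = 0}
  zero_mem' := by
    refine ⟨by simp, ?_⟩
    have : GraphState.hat (0 : GraphState n m) = 0 := by
      ext (i | i) <;> rfl
    rw [this, Matrix.mulVec_zero]
  add_mem' := by
    rintro ψ φ ⟨h1, h2⟩ ⟨h3, h4⟩
    refine ⟨fun x j => ?_, ?_⟩
    · simp only [Pi.add_apply]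
      rw [h1 x j, h3 x j]; ring
    · have : GraphState.hat (ψ + φ) = ψ.hat + φ.hat := by
        ext (i | i) <;> rfl
      rw [this, Matrix.mulVec_add, h2, h4, add_zero]
  smul_mem' := by
    rintro c ψ ⟨h1, h2⟩
    refine ⟨fun x j => ?_, ?_⟩
    · simp only [Pi.smul_apply, smul_eq_mul]
      rw [h1 x j]; ring
    · have : GraphState.hat (c • ψ) = c • ψ.hat := by
        ext (i | i) <;> rfl
      rw [this, Matrix.mulVec_smul, h2, smul_zero]

/-- For `z ≠ 0`, the states in `solutionSpace z` are exactly the eigenstates of the Hamiltonian, of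
energy `z + 1/z`, that have the form `α_j z^{x-1}` on the paths. -/
theorem mem_solutionSpace_iff_ham {z : ℂ} (hz : z ≠ 0) (ψ : GraphState n m) :
    ψ ∈ G.solutionSpace z ↔
      (∀ x j, ψ (.path x j) = ψ (.path 0 j) * z ^ x) ∧ G.ham ψ = (z + z⁻¹) • ψ := by
  have hB : G.blockBᴴ = G.hamHat.toBlocks₁₂ := by
    ext i j
    simp [blockB, hamHat, Matrix.toBlocks₂₁, Matrix.toBlocks₁₂,
      G.weight_symm (Sum.inr j) (Sum.inl i)]
  have hl : ∀ j, (G.gamma z *ᵥ ψ.hat) (Sum.inl j) =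
      z * (G.hamHat *ᵥ ψ.hat) (Sum.inl j) - ψ (.path 0 j) := by
    intro j
    rw [gamma, hB]
    simp [Matrix.mulVec, dotProduct, Matrix.fromBlocks, GraphState.hat, blockA,
      Matrix.toBlocks₁₁, Matrix.toBlocks₁₂, sub_mul, Finset.sum_sub_distrib, mul_add,
      Finset.mul_sum, Matrix.one_apply]
    simp only [mul_assoc]
    ring
  have hr : ∀ i, (G.gamma z *ᵥ ψ.hat) (Sum.inr i) =
      z * (G.hamHat *ᵥ ψ.hat) (Sum.inr i) - (z ^ 2 + 1) * ψ (.internal i) := by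
    intro i
    simp [gamma, Matrix.mulVec, dotProduct, Matrix.fromBlocks, GraphState.hat, blockB, blockD,
      Matrix.toBlocks₂₁, Matrix.toBlocks₂₂, sub_mul, Finset.sum_sub_distrib, mul_add,
      Finset.mul_sum, Matrix.one_apply]
    simp only [mul_assoc]
    ring
  change (_ ∧ _) ↔ _
  refine and_congr_right fun hψ => ?_
  constructor
  · intro h
    ext v
    rcases v with ⟨x, j⟩ | i
    · rcases x with _ | x
      · have h0 := (hl j).symm.trans (congrFun h (Sum.inl j))
        simp only [ham, Pi.smul_apply, smul_eq_mul, hψ 1 j, Pi.zero_apply] at h0 ⊢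
        field_simp
        linear_combination h0
      · simp only [ham, Pi.smul_apply, smul_eq_mul, hψ x j, hψ (x + 1) j, hψ (x + 2) j]
        field_simp
        ring
    · have h0 := (hr i).symm.trans (congrFun h (Sum.inr i))
      simp only [ham, Pi.smul_apply, smul_eq_mul, Pi.zero_apply] at h0 ⊢
      field_simp
      linear_combination h0
  · intro h
    ext (j | i)
    · have h0 := congrFun h (.path 0 j)
      simp only [ham, Pi.smul_apply, smul_eq_mul, hψ 1 j] at h0
      rw [hl j, Pi.zero_apply]
      field_simp at h0
      linear_combination h0
    · have h0 := congrFun h (.internal i)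
      simp only [ham, Pi.smul_apply, smul_eq_mul] at h0
      rw [hr i, Pi.zero_apply]
      field_simp at h0
      linear_combination h0

/-- The span of the confined states with parameter in `Z`: the states `ψ` that vanish on all the
paths and satisfy `γ(z) ψ̂ = 0` for some `z ∈ Z`. -/
def confinedSpan (Z : Set ℂ) : Submodule ℂ (GraphState n m) :=
  Submodule.span ℂ {ψ | (∀ x j, ψ (.path x j) = 0) ∧ ∃ z ∈ Z, G.gamma z *ᵥ ψ.hat = 0}

/-- Confined bound states with energy of absolute value greater than `2`. -/
def confGT : Submodule ℂ (GraphState n m) := G.confinedSpan {z | ‖z‖ < 1}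

/-- Confined bound states with energy of absolute value less than `2`. -/
def confLT : Submodule ℂ (GraphState n m) := G.confinedSpan {z | ‖z‖ = 1 ∧ z ≠ 1 ∧ z ≠ -1}

/-- Confined bound states with energy `2` or `-2`. -/
def confEQ : Submodule ℂ (GraphState n m) := G.confinedSpan {1, -1}

/-- The states orthogonal to every state in `C`. It is used only for spaces `C` of states that
vanish on the paths, so that the inner product is a sum over the vertices of the finite graph. -/
def orth (C : Submodule ℂ (GraphState n m)) : Submodule ℂ (GraphState n m) where
  carrier := {ψ | ∀ φ ∈ C, star φ.hat ⬝ᵥ ψ.hat = 0}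
  zero_mem' := by
    intro φ _
    have : GraphState.hat (0 : GraphState n m) = 0 := by
      ext (i | i) <;> rfl
    rw [this, dotProduct_zero]
  add_mem' := by
    intro ψ ψ' h h' φ hφ
    have : GraphState.hat (ψ + ψ') = ψ.hat + ψ'.hat := by
      ext (i | i) <;> rfl
    rw [this, dotProduct_add, h φ hφ, h' φ hφ, add_zero]
  smul_mem' := by
    intro c ψ h φ hφ
    have : GraphState.hat (c • ψ) = c • ψ.hat := by
      ext (i | i) <;> rfl
    rw [this, dotProduct_smul, h φ hφ, smul_zero]

/-- The number `n_c` of confined bound states. -/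
def numConfined : ℕ := Module.finrank ℂ ↥(G.confGT ⊔ G.confLT ⊔ G.confEQ)

/-- The number `n_b` of unconfined bound states. (The sum is over a finite set: `det γ` is a
nonzero polynomial since `γ(0) = -1`.) -/
def numUnconfined : ℕ :=
  ∑ᶠ x ∈ {x : ℝ | -1 < x ∧ x < 1 ∧ (G.gamma (x : ℂ)).det = 0},
    Module.finrank ℂ ↥(G.solutionSpace (x : ℂ) ⊓ orth G.confGT)

/-- The number `n_h` of half-bound states. -/
def numHalfBound : ℕ :=
  Module.finrank ℂ ↥(G.solutionSpace 1 ⊓ orth G.confEQ) +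
    Module.finrank ℂ ↥(G.solutionSpace (-1) ⊓ orth G.confEQ)

end

end ScatteringGraph

/-- `f` is continuous and nonzero on the unit circle, and its winding number around `0` along the
positively oriented circle is `w`: a continuous choice of the phase of `f (e^{ik})` increases by
`2πw` as `k` goes from `-π` to `π`. -/
def HasCircleWindingNumber (f : ℂ → ℂ) (w : ℤ) : Prop :=
  ContinuousOn f (Metric.sphere 0 1) ∧ (∀ z ∈ Metric.sphere (0 : ℂ) 1, f z ≠ 0) ∧
  ∃ θ : ℝ → ℝ, ContinuousOn θ (Set.Icc (-Real.pi) Real.pi) ∧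
    (∀ k ∈ Set.Icc (-Real.pi) Real.pi,
      f (Complex.exp (Complex.I * k)) =
        ‖f (Complex.exp (Complex.I * k))‖ * Complex.exp (Complex.I * θ k)) ∧
    θ Real.pi - θ (-Real.pi) = 2 * Real.pi * w

/-! The matrix `-γ(z)⁻¹ γ(1/z)` is block triangular with lower right block `-z⁻²`, so `det S =
(-1)^n z^{2m} det γ(1/z) / det γ(z)` (`det_fullScattering_block`). The polynomial `det γ` has real
coefficients, so its roots are closed under conjugation and the quotient is the product over the
roots `ζ` of `(1/z - conj ζ)/(z - ζ)`. On the unit circle such a factor is `conj (z - ζ)/(z - ζ)`.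
It winds `-2` times if `|ζ| < 1` and not at all if `|ζ| > 1`; if `|ζ| = 1` it cancels to `-conj ζ /
z` and winds `-1` times. Hence the winding number is `2m` minus twice the number of roots inside the
circle minus the number of roots on it, with multiplicity (`hasWinding_det_sMatrix`).

It remains to read the multiplicities off the kernels of `γ`. On confined vectors at `z`, `γ(X)` is
the scalar `-(X - z)(X - 1/z)`, and the corresponding power splits off `det γ`
(`exists_detGamma_deflation`). What is left is controlled by pairing `γ(z) v = 0` with `v`
(`exists_energy`): roots in the open disk are real; at nonreal points of the circle the whole kernel
is confined; at a real `x ≠ 0` in `[-1, 1]` the derivative of `γ` is definite on the unconfined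
kernel, which therefore contributes exactly its dimension (`exists_detGamma_eq_of_real`).

So each confined state costs 2, whether through one root in the disk, a conjugate pair on the circle
or a double root at `±1`; an unconfined bound state costs 2 and a half-bound state 1. -/

theorem RatFunc.eval_algebraMap_div {K : Type*} [Field K] (p q : Polynomial K) {z : K}
    (hq : q.eval z ≠ 0) :
    RatFunc.eval (RingHom.id K) z (algebraMap _ (RatFunc K) p / algebraMap _ _ q) =
      p.eval z / q.eval z := by
  have hq0 : q ≠ 0 := by rintro rfl; simp at hq
  -- `RatFunc.eval` uses the reduced fraction, whose denominator divides `q`.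
  have hd : (RatFunc.denom (algebraMap _ (RatFunc K) p / algebraMap _ _ q)).eval z ≠ 0 := by
    obtain ⟨r, hr⟩ := RatFunc.denom_div_dvd p q
    intro h
    apply hq
    rw [hr, Polynomial.eval_mul, h, zero_mul]
  have key := (RatFunc.num_mul_eq_mul_denom_iff (x := algebraMap _ (RatFunc K) p / algebraMap _ _ q)
    (p := p) hq0).2 rfl
  have := congrArg (Polynomial.eval z) key
  simp only [Polynomial.eval_mul] at this
  rw [RatFunc.eval, Polynomial.eval₂_id, Polynomial.eval₂_id, div_eq_div_iff hd hq, this]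

/-! ### Winding numbers along the unit circle -/

namespace HasCircleWindingNumber

variable {f g : ℂ → ℂ} {v w : ℤ}

theorem congr (hf : HasCircleWindingNumber f w)
    (h : ∀ z ∈ Metric.sphere (0 : ℂ) 1, g z = f z) : HasCircleWindingNumber g w := by
  obtain ⟨hc, h0, θ, hθ, he, hw⟩ := hf
  have hs : ∀ k : ℝ, Complex.exp (Complex.I * k) ∈ Metric.sphere (0 : ℂ) 1 := fun k => by
    simp [mul_comm Complex.I, Complex.norm_exp_ofReal_mul_I]
  refine ⟨hc.congr h, fun z hz => by rw [h z hz]; exact h0 z hz, θ, hθ, fun k hk => ?_, hw⟩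
  rw [h _ (hs k)]
  exact he k hk

theorem mul (hf : HasCircleWindingNumber f v) (hg : HasCircleWindingNumber g w) :
    HasCircleWindingNumber (fun z => f z * g z) (v + w) := by
  obtain ⟨hc, h0, θ, hθ, he, hw⟩ := hf
  obtain ⟨hc', h0', θ', hθ', he', hw'⟩ := hg
  refine ⟨hc.mul hc', fun z hz => mul_ne_zero (h0 z hz) (h0' z hz), fun k => θ k + θ' k,
    hθ.add hθ', fun k hk => ?_, by push_cast; linear_combination hw + hw'⟩
  have e : Complex.exp (Complex.I * ((θ k + θ' k : ℝ) : ℂ)) =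
      Complex.exp (Complex.I * θ k) * Complex.exp (Complex.I * θ' k) := by
    rw [← Complex.exp_add]; push_cast; ring_nf
  simp only [norm_mul, Complex.ofReal_mul]
  rw [e]
  conv_lhs => rw [he k hk, he' k hk]
  ring

theorem star (hf : HasCircleWindingNumber f w) :
    HasCircleWindingNumber (fun z => conj (f z)) (-w) := by
  obtain ⟨hc, h0, θ, hθ, he, hw⟩ := hf
  refine ⟨Complex.continuous_conj.comp_continuousOn hc,
    fun z hz => by simpa using h0 z hz, fun k => -θ k, hθ.neg, fun k hk => ?_, by
      push_cast; linear_combination -hw⟩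
  have e : Complex.exp (Complex.I * ((-θ k : ℝ) : ℂ)) = conj (Complex.exp (Complex.I * θ k)) := by
    rw [← Complex.exp_conj]; simp
  rw [e]
  beta_reduce
  conv_lhs => rw [he k hk]
  simp

theorem inv (hf : HasCircleWindingNumber f w) :
    HasCircleWindingNumber (fun z => (f z)⁻¹) (-w) := by
  obtain ⟨hc, h0, θ, hθ, he, hw⟩ := hf
  refine ⟨hc.inv₀ h0, fun z hz => inv_ne_zero (h0 z hz), fun k => -θ k, hθ.neg,
    fun k hk => ?_, by push_cast; linear_combination -hw⟩
  have e : Complex.exp (Complex.I * ((-θ k : ℝ) : ℂ)) = (Complex.exp (Complex.I * θ k))⁻¹ := by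
    rw [← Complex.exp_neg]; simp
  rw [e]
  beta_reduce
  conv_lhs => rw [he k hk]
  simp [mul_comm]

theorem const {c : ℂ} (hc : c ≠ 0) : HasCircleWindingNumber (fun _ => c) 0 := by
  refine ⟨continuousOn_const, fun _ _ => hc, fun _ => c.arg, continuousOn_const,
    fun k _ => ?_, by simp⟩
  beta_reduce
  rw [mul_comm Complex.I (c.arg : ℂ)]
  exact (Complex.norm_mul_exp_arg_mul_I c).symm

theorem id : HasCircleWindingNumber (fun z => z) 1 := by
  refine ⟨continuousOn_id, fun z hz => ?_, fun k => k, continuousOn_id, fun k _ => ?_, ?_⟩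
  · rintro rfl
    simp at hz
  · simp [mul_comm Complex.I, Complex.norm_exp_ofReal_mul_I]
  · push_cast; ring

/-- On the right half-plane the principal argument is a continuous phase, and it is single-valued
along the closed circle. -/
theorem of_re_pos (hf : ContinuousOn f (Metric.sphere 0 1))
    (h : ∀ z ∈ Metric.sphere (0 : ℂ) 1, 0 < (f z).re) : HasCircleWindingNumber f 0 := by
  have hs : ∀ k : ℝ, Complex.exp (Complex.I * k) ∈ Metric.sphere (0 : ℂ) 1 := fun k => by
    simp [mul_comm Complex.I, Complex.norm_exp_ofReal_mul_I]
  refine ⟨hf, fun z hz h0 => ?_, fun k => (f (Complex.exp (Complex.I * k))).arg, ?_,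
    fun k _ => ?_, ?_⟩
  · have := h z hz
    simp [h0] at this
  · refine Complex.continuousOn_arg.comp (hf.comp (by fun_prop) fun k _ => hs k) fun k _ => ?_
    exact Complex.mem_slitPlane_iff.2 (Or.inl (h _ (hs k)))
  · conv_lhs => rw [← Complex.norm_mul_exp_arg_mul_I (f (Complex.exp (Complex.I * k)))]
    rw [mul_comm Complex.I (Complex.ofReal (Complex.arg _))]
  · have : Complex.exp (Complex.I * Real.pi) = Complex.exp (Complex.I * (-Real.pi : ℝ)) := by
      rw [mul_comm, Complex.exp_pi_mul_I]
      push_cast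
      rw [mul_neg, Complex.exp_neg, mul_comm, Complex.exp_pi_mul_I]
      norm_num
    simp [this]

theorem re_one_sub_pos {a : ℂ} (ha : ‖a‖ < 1) : 0 < (1 - a).re := by
  have := (Complex.abs_re_le_norm a)
  have := le_abs_self a.re
  simp only [Complex.sub_re, Complex.one_re]
  linarith

/-- Write `z - ζ = -ζ (1 - z/ζ)`; the last factor stays in the right half-plane. -/
theorem sub_const_of_one_lt {ζ : ℂ} (hζ : 1 < ‖ζ‖) :
    HasCircleWindingNumber (fun z => z - ζ) 0 := by
  have h0 : ζ ≠ 0 := by rintro rfl; simp at hζ; linarith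
  have h1 := (const (neg_ne_zero.2 h0)).mul (of_re_pos (f := fun z => 1 - z / ζ)
    (by fun_prop) fun z hz => re_one_sub_pos (by
      rw [norm_div, mem_sphere_zero_iff_norm.1 hz, div_lt_one (by linarith)]; exact hζ))
  refine h1.congr fun z _ => ?_
  field_simp
  ring

/-- Write `z - ζ = z (1 - ζ/z)`; the turn comes from the factor `z` alone. -/
theorem sub_const_of_lt_one {ζ : ℂ} (hζ : ‖ζ‖ < 1) :
    HasCircleWindingNumber (fun z => z - ζ) 1 := by
  have hne : ∀ z ∈ Metric.sphere (0 : ℂ) 1, z ≠ 0 := by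
    rintro z hz rfl
    simp at hz
  have h1 := id.mul (of_re_pos (f := fun z => 1 - ζ / z)
    (continuousOn_const.sub (continuousOn_const.div continuousOn_id hne))
    fun z hz => re_one_sub_pos (by
      rw [norm_div, mem_sphere_zero_iff_norm.1 hz, div_one]; exact hζ))
  refine h1.congr fun z hz => ?_
  have := hne z hz
  field_simp

end HasCircleWindingNumber

/-- `f` has neither zeros nor poles on the unit circle, and winds `w` times around `0` along it. -/
def RatFunc.HasWinding (f : RatFunc ℂ) (w : ℤ) : Prop :=
  (∀ z ∈ Metric.sphere (0 : ℂ) 1, f.denom.eval z ≠ 0) ∧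
    HasCircleWindingNumber (fun z => RatFunc.eval (RingHom.id ℂ) z f) w

/-! ### Winding numbers of rational functions -/

namespace RatFunc.HasWinding

variable {f g : RatFunc ℂ} {v w : ℤ}

theorem mul (hf : f.HasWinding v) (hg : g.HasWinding w) : (f * g).HasWinding (v + w) := by
  refine ⟨fun z hz h => ?_, (hf.2.mul hg.2).congr fun z hz => ?_⟩
  · obtain ⟨r, hr⟩ := RatFunc.denom_mul_dvd f g
    have := congrArg (Polynomial.eval z) hr
    rw [Polynomial.eval_mul, Polynomial.eval_mul, h, zero_mul] at this
    exact mul_ne_zero (hf.1 z hz) (hg.1 z hz) this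
  · exact RatFunc.eval_mul _ _ (by rw [Polynomial.eval₂_id]; exact hf.1 z hz)
      (by rw [Polynomial.eval₂_id]; exact hg.1 z hz)

theorem of_div {p q : Polynomial ℂ} (hq : ∀ z ∈ Metric.sphere (0 : ℂ) 1, q.eval z ≠ 0)
    (h : HasCircleWindingNumber (fun z => p.eval z / q.eval z) w) :
    (algebraMap _ (RatFunc ℂ) p / algebraMap _ _ q).HasWinding w := by
  refine ⟨fun z hz hd => ?_, h.congr fun z hz => RatFunc.eval_algebraMap_div p q (hq z hz)⟩
  obtain ⟨r, hr⟩ := RatFunc.denom_div_dvd p q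
  apply hq z hz
  rw [hr, Polynomial.eval_mul, hd, zero_mul]

theorem C {c : ℂ} (hc : c ≠ 0) : (RatFunc.C c).HasWinding 0 := by
  have := of_div (p := Polynomial.C c) (q := 1) (w := 0) (by simp)
    (by simpa using HasCircleWindingNumber.const hc)
  simpa using this

theorem X : (RatFunc.X : RatFunc ℂ).HasWinding 1 := by
  have := of_div (p := Polynomial.X) (q := 1) (w := 1) (by simp)
    (by simpa using HasCircleWindingNumber.id)
  simpa using this

theorem pow (hf : f.HasWinding w) (k : ℕ) : (f ^ k).HasWinding (k * w) := by
  induction k with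
  | zero => simpa using C one_ne_zero
  | succ k ih =>
    rw [pow_succ]
    have := ih.mul hf
    convert this using 1
    push_cast; ring

/-- The winding number of `(1/z - conj ζ) / (z - ζ)`. -/
theorem reflection (ζ : ℂ) :
    ((RatFunc.X⁻¹ - RatFunc.C (conj ζ)) / (RatFunc.X - RatFunc.C ζ)).HasWinding
      (-(if ‖ζ‖ < 1 then 2 else 0) - (if ‖ζ‖ = 1 then 1 else 0)) := by
  have hX : (RatFunc.X : RatFunc ℂ) ≠ 0 := RatFunc.X_ne_zero
  have hne : ∀ z ∈ Metric.sphere (0 : ℂ) 1, z ≠ 0 := by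
    rintro z hz rfl
    simp at hz
  have hsub : (RatFunc.X : RatFunc ℂ) - RatFunc.C ζ ≠ 0 := by
    have := RatFunc.algebraMap_ne_zero (Polynomial.X_sub_C_ne_zero ζ)
    simpa using this
  have hnorm : ∀ z ∈ Metric.sphere (0 : ℂ) 1, conj z = z⁻¹ := fun z hz => by
    rw [Complex.inv_def, Complex.normSq_eq_norm_sq, mem_sphere_zero_iff_norm.1 hz]
    simp
  by_cases h1 : ‖ζ‖ = 1
  · have hc : conj ζ ≠ 0 := by
      rw [Ne, map_eq_zero]; exact hne ζ (by simpa using h1)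
    -- Here `conj ζ = 1/ζ`, so the pole on the circle cancels against the numerator.
    have e : (RatFunc.X⁻¹ - RatFunc.C (conj ζ)) / (RatFunc.X - RatFunc.C ζ) =
        algebraMap _ (RatFunc ℂ) (Polynomial.C (-conj ζ)) / algebraMap _ _ (Polynomial.X : Polynomial ℂ) := by
      have hz : RatFunc.C (conj ζ) * RatFunc.C ζ = 1 := by
        rw [← map_mul, hnorm ζ (by simpa using h1), inv_mul_cancel₀ (hne ζ (by simpa using h1)),
          map_one]
      rw [RatFunc.algebraMap_C, RatFunc.algebraMap_X, div_eq_div_iff hsub hX, sub_mul,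
        inv_mul_cancel₀ hX, map_neg]
      linear_combination -hz
    rw [e]
    have h : HasCircleWindingNumber (fun z => -conj ζ * z⁻¹) (0 + -1) :=
      (HasCircleWindingNumber.const (neg_ne_zero.2 hc)).mul HasCircleWindingNumber.id.inv
    refine of_div (fun z hz => by simpa using hne z hz) ?_
    simpa [h1, div_eq_mul_inv] using h
  · have e : (RatFunc.X⁻¹ - RatFunc.C (conj ζ)) / (RatFunc.X - RatFunc.C ζ) =
        algebraMap _ (RatFunc ℂ) (1 - Polynomial.C (conj ζ) * Polynomial.X) /
          algebraMap _ _ (Polynomial.X * (Polynomial.X - Polynomial.C ζ)) := by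
      simp only [map_sub, map_mul, map_one, RatFunc.algebraMap_C, RatFunc.algebraMap_X]
      field_simp
    rw [e]
    obtain ⟨v, hv, hw⟩ : ∃ v : ℤ, HasCircleWindingNumber (fun z => z - ζ) v ∧
        -(if ‖ζ‖ < 1 then 2 else 0) - (if ‖ζ‖ = 1 then 1 else 0) = -v + -v := by
      rcases lt_or_gt_of_ne h1 with h | h
      · exact ⟨1, .sub_const_of_lt_one h, by simp [h, h1]⟩
      · exact ⟨0, .sub_const_of_one_lt h, by simp [h.not_gt, h1]⟩
    rw [hw]
    -- On the circle `1/z = conj z`, so the factor is `conj (z - ζ) / (z - ζ)` and winds `-v - v`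
    -- times.
    refine of_div (fun z hz => ?_) ((hv.star.mul hv.inv).congr fun z hz => ?_)
    · simpa using ⟨hne z hz, hv.2.1 z hz⟩
    · have := hne z hz
      have h3 := hv.2.1 z hz
      simp only [map_sub, hnorm z hz, Polynomial.eval_sub, Polynomial.eval_one, Polynomial.eval_mul,
        Polynomial.eval_C, Polynomial.eval_X]
      field_simp

theorem multiset_reflection (s : Multiset ℂ) :
    ((s.map fun ζ => (RatFunc.X⁻¹ - RatFunc.C (conj ζ)) / (RatFunc.X - RatFunc.C ζ)).prod).HasWinding
      (-2 * (s.countP (‖·‖ < 1) : ℤ) - s.countP (‖·‖ = 1)) := by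
  induction s using Multiset.induction_on with
  | empty => simpa using C one_ne_zero
  | cons a s ih =>
    rw [Multiset.map_cons, Multiset.prod_cons]
    convert (reflection a).mul ih using 1
    rw [Multiset.countP_cons, Multiset.countP_cons]
    split_ifs <;> push_cast <;> ring

end RatFunc.HasWinding

/-! ### Kernels and orders of vanishing of determinants -/

section LinearAlgebra

/-- Every subspace of `ℂ^ι` is the range of an isometry. -/
theorem Submodule.exists_isometry_matrix {ι : Type*} [Fintype ι] (K : Submodule ℂ (ι → ℂ)) :
    ∃ V : Matrix ι (Fin (Module.finrank ℂ K)) ℂ, Vᴴ * V = 1 ∧ (∀ u, V *ᵥ u ∈ K) ∧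
      ∀ v ∈ K, V *ᵥ (Vᴴ *ᵥ v) = v := by
  let e := WithLp.linearEquiv 2 ℂ (ι → ℂ)
  let K' : Submodule ℂ (EuclideanSpace ℂ ι) := K.map (e.symm : (ι → ℂ) →ₗ[ℂ] EuclideanSpace ℂ ι)
  have hK' : Module.finrank ℂ K' = Module.finrank ℂ K := LinearEquiv.finrank_map_eq e.symm K
  have hmem : ∀ v, WithLp.toLp 2 v ∈ K' ↔ v ∈ K := fun v => by
    constructor
    · rintro ⟨w, hw, hwv⟩
      have : w = v := e.symm.injective hwv
      exact this ▸ hw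
    · exact fun h => ⟨v, h, rfl⟩
  let b := (stdOrthonormalBasis ℂ K').reindex (finCongr hK')
  refine ⟨Matrix.of fun i a => WithLp.ofLp (b a : EuclideanSpace ℂ ι) i, ?_, fun u => ?_,
    fun v hv => ?_⟩
  · ext a c
    have h := orthonormal_iff_ite.1 b.orthonormal a c
    rw [Submodule.coe_inner, EuclideanSpace.inner_eq_star_dotProduct] at h
    rw [Matrix.mul_apply, Matrix.one_apply, ← h]
    exact Finset.sum_congr rfl fun i _ => mul_comm _ _
  · rw [← hmem]
    have h : (WithLp.toLp 2 (Matrix.of (fun i a => WithLp.ofLp (b a : EuclideanSpace ℂ ι) i) *ᵥ u))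
        = ((∑ a, u a • b a : K') : EuclideanSpace ℂ ι) := by
      ext i
      simp [Matrix.mulVec, dotProduct, mul_comm]
    rw [h]
    exact Submodule.coe_mem _
  · have h := b.sum_repr' ⟨WithLp.toLp 2 v, (hmem v).2 hv⟩
    have h2 := congrArg (fun y : K' => WithLp.ofLp (y : EuclideanSpace ℂ ι)) h
    funext i
    have h3 := congrFun h2 i
    simp only [Submodule.coe_inner, EuclideanSpace.inner_eq_star_dotProduct] at h3
    rw [← h3]
    simp [Matrix.mulVec, dotProduct, mul_comm]

variable {ι κ : Type*} [Fintype ι] [DecidableEq ι] [Fintype κ] [DecidableEq κ]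

/-- The matrix multiplies the range of `V` by `f` and fixes the kernel of `W`; Sylvester's
determinant identity reduces the claim to a scalar `κ × κ` matrix. -/
theorem Matrix.det_one_add_smul_mul {R : Type*} [CommRing R] (V : Matrix ι κ R)
    (W : Matrix κ ι R) (hWV : W * V = 1) (f : R) :
    (1 + (f - 1) • (V * W)).det = f ^ Fintype.card κ := by
  have h : (f - 1) • (V * W) = V * ((f - 1) • W) := by rw [Matrix.mul_smul]
  rw [h, Matrix.det_one_add_mul_comm, Matrix.smul_mul, hWV,
    show (1 : Matrix κ κ R) + (f - 1) • 1 = f • 1 by rw [sub_smul, one_smul]; abel,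
    Matrix.det_smul, Matrix.det_one, mul_one]

/-- Splitting off an eigenspace from a determinant. -/
theorem Matrix.det_eq_pow_mul_det {R : Type*} [CommRing R] (M : Matrix ι ι R) (V : Matrix ι κ R)
    (W : Matrix κ ι R) (hWV : W * V = 1) (f : R) (hM : M * V = f • V) :
    M.det = f ^ Fintype.card κ * (M * (1 - V * W) + V * W).det := by
  -- `M` factors as `(M (1 - VW) + VW) (1 + (f - 1) VW)`.
  rw [← Matrix.det_one_add_smul_mul V W hWV f, mul_comm, ← Matrix.det_mul]
  congr 1
  have h1 : V * W * (V * W) = V * W := by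
    rw [Matrix.mul_assoc, ← Matrix.mul_assoc W, hWV, Matrix.one_mul]
  have h2 : M * (V * W) = f • (V * W) := by
    rw [← Matrix.mul_assoc, hM, Matrix.smul_mul]
  have h3 : (M * (1 - V * W) + V * W) * (V * W) = V * W := by
    rw [Matrix.add_mul, Matrix.mul_assoc, Matrix.sub_mul, h1]
    simp
  rw [Matrix.mul_add, Matrix.mul_one, Matrix.mul_smul, h3, Matrix.mul_sub, h2, Matrix.mul_one]
  module

open Polynomial in
/-- The order of vanishing of `det (M₀ + (X - z₀) M₁)` at `z₀` if the compression of `M₁ z₀` to the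
kernel of `M₀` is nondegenerate. -/
theorem Matrix.exists_det_eq_X_sub_C_pow_mul (z₀ : ℂ) (M₀ : Matrix ι ι ℂ) (M₁ : Matrix ι ι ℂ[X])
    (V : Matrix ι κ ℂ) (hV : Vᴴ * V = 1) (hl : Vᴴ * M₀ = 0)
    (h : ∀ v, M₀ *ᵥ v = 0 → Vᴴ *ᵥ (M₁.map (eval z₀) *ᵥ v) = 0 → v = 0) :
    ∃ q : ℂ[X], q.eval z₀ ≠ 0 ∧
      (M₀.map C + (X - C z₀) • M₁).det = (X - C z₀) ^ Fintype.card κ * q := by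
  set P : Matrix ι ι ℂ := V * Vᴴ with hP
  have hPM : P * M₀ = 0 := by rw [hP, Matrix.mul_assoc, hl, Matrix.mul_zero]
  have hPP : P * P = P := by
    rw [hP, Matrix.mul_assoc, ← Matrix.mul_assoc Vᴴ, hV, Matrix.one_mul]
  have hPC : P.map C = V.map C * Vᴴ.map (C : ℂ →+* ℂ[X]) := Matrix.map_mul
  have hPMC : P.map C * M₀.map C = (0 : Matrix ι ι ℂ[X]) := by
    rw [← Matrix.map_mul, hPM]; simp
  have hPPC : P.map C * P.map C = (P.map C : Matrix ι ι ℂ[X]) := by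
    rw [← Matrix.map_mul, hPP]
  -- Since `P M₀ = 0`, the `P`-component of the matrix is divisible by `X - z₀`; `N` is the result
  -- of dividing only that component.
  set N : Matrix ι ι ℂ[X] := (1 - P.map C) * (M₀.map C + (X - C z₀) • M₁) + P.map C * M₁ with hN
  refine ⟨N.det, ?_, ?_⟩
  · have hdet : N.det.eval z₀ = ((1 - P) * M₀ + P * M₁.map (eval z₀)).det := by
      rw [← Polynomial.coe_evalRingHom, RingHom.map_det]
      congr 1
      have hid : ∀ A : Matrix ι ι ℂ, (evalRingHom z₀).mapMatrix (A.map C) = A := fun A => by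
        ext; simp
      have hX : (evalRingHom z₀).mapMatrix ((X - C z₀) • M₁) = 0 := by
        ext; simp
      rw [hN, map_add, map_mul, map_mul, map_sub, map_one, map_add, hid, hid, hX, add_zero]
      rfl
    rw [hdet, Ne, ← Matrix.exists_mulVec_eq_zero_iff]
    rintro ⟨v, hv, h0⟩
    have h1 : P *ᵥ (M₁.map (eval z₀) *ᵥ v) = 0 := by
      have := congrArg (P *ᵥ ·) h0
      simp only [Matrix.mulVec_mulVec, Matrix.mulVec_zero, Matrix.mul_add, ← Matrix.mul_assoc,
        Matrix.mul_sub, Matrix.mul_one, hPP, sub_self, Matrix.zero_mul, zero_add] at this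
      rwa [Matrix.mulVec_mulVec]
    have h2 : M₀ *ᵥ v = 0 := by
      rw [Matrix.add_mulVec, ← Matrix.mulVec_mulVec v P, h1, add_zero, Matrix.sub_mul, hPM,
        Matrix.one_mul, sub_zero] at h0
      exact h0
    refine hv (h v h2 ?_)
    have := congrArg (Vᴴ *ᵥ ·) h1
    simp only [Matrix.mulVec_mulVec, Matrix.mulVec_zero, hP, ← Matrix.mul_assoc, hV,
      Matrix.one_mul] at this
    rwa [Matrix.mulVec_mulVec]
  · rw [← Matrix.det_one_add_smul_mul (V.map C) (Vᴴ.map (C : ℂ →+* ℂ[X]))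
      (by rw [← Matrix.map_mul, hV]; simp), ← Matrix.det_mul, ← hPC]
    congr 1
    simp only [hN, Matrix.mul_add, Matrix.add_mul, Matrix.sub_mul, Matrix.one_mul, Matrix.mul_smul,
      Matrix.smul_mul, ← Matrix.mul_assoc, Matrix.mul_sub, hPPC, hPMC, Matrix.mul_zero]
    module

open Polynomial in
theorem Polynomial.rootMultiplicity_X_sub_C_pow_mul {K : Type*} [Field K] {z : K} {q : K[X]}
    (hq : q.eval z ≠ 0) (k : ℕ) : ((X - C z) ^ k * q).rootMultiplicity z = k := by
  have hq0 : q ≠ 0 := by rintro rfl; simp at hq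
  rw [mul_comm, rootMultiplicity_mul_X_sub_C_pow hq0, rootMultiplicity_eq_zero hq, zero_add]

theorem Submodule.finrank_biSup_of_iSupIndep {α F V : Type*} [Field F] [AddCommGroup V]
    [Module F V] [FiniteDimensional F V] (A : α → Submodule F V) (s : Finset α)
    (hA : ∀ a ∈ s, ∀ t ⊆ s, a ∉ t → Disjoint (A a) (⨆ b ∈ t, A b)) :
    Module.finrank F ↥(⨆ a ∈ s, A a) = ∑ a ∈ s, Module.finrank F (A a) := by
  classical
  induction s using Finset.induction_on with
  | empty => simp
  | insert a s ha ih =>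
    rw [Finset.iSup_insert, Finset.sum_insert ha, ← ih fun b hb t ht =>
      hA b (Finset.mem_insert_of_mem hb) t (ht.trans (Finset.subset_insert _ _)),
      ← Submodule.finrank_sup_add_finrank_inf_eq,
      (hA a (Finset.mem_insert_self _ _) s (Finset.subset_insert _ _) ha).eq_bot, finrank_bot,
      add_zero]

theorem Multiset.countP_eq_sum_count {α : Type*} [DecidableEq α] (s : Multiset α) (P : α → Prop)
    [DecidablePred P] : s.countP P = ∑ a ∈ s.toFinset.filter P, s.count a := by
  rw [Multiset.countP_eq_card_filter, ← Multiset.toFinset_sum_count_eq, Multiset.toFinset_filter]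
  exact Finset.sum_congr rfl fun a ha => Multiset.count_filter_of_pos (Finset.mem_filter.1 ha).2

end LinearAlgebra

/-! ### The matrix `γ`, its kernels and the energy balance -/

namespace ScatteringGraph

variable {n m : ℕ} (G : ScatteringGraph n m)

/-- The projection onto the internal vertices. -/
def internalProj (n m : ℕ) (R : Type) [CommRing R] : Matrix (Fin n ⊕ Fin m) (Fin n ⊕ Fin m) R :=
  Matrix.fromBlocks 0 0 0 1

theorem blockB_conjTranspose : G.blockBᴴ = G.hamHat.toBlocks₁₂ := by
  ext i j
  simp [blockB, hamHat, Matrix.toBlocks₂₁, Matrix.toBlocks₁₂,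
    G.weight_symm (Sum.inr j) (Sum.inl i)]

theorem hamHat_conjTranspose : G.hamHatᴴ = G.hamHat := by
  ext u v
  rw [Matrix.conjTranspose_apply]
  exact (G.weight_symm _ _).symm

theorem gamma_eq {R : Type} [CommRing R] [Algebra ℂ R] (z : R) :
    G.gamma z = z • G.hamHat.map (algebraMap ℂ R) - z ^ 2 • internalProj n m R - 1 := by
  rw [gamma, blockB_conjTranspose, ← Matrix.fromBlocks_one, internalProj]
  ext (i | i) (j | j) <;>
    simp [blockA, blockB, blockD, Matrix.toBlocks₁₁, Matrix.toBlocks₁₂, Matrix.toBlocks₂₁,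
      Matrix.toBlocks₂₂, Matrix.one_apply]

/-- Naturality moves identities between polynomials, rational functions and complex values. -/
theorem gamma_map {R S : Type} [CommRing R] [Algebra ℂ R] [CommRing S] [Algebra ℂ S]
    (φ : R →ₐ[ℂ] S) (z : R) : (G.gamma z).map φ = G.gamma (φ z) := by
  rw [gamma_eq, gamma_eq, internalProj, internalProj]
  ext (i | i) (j | j) <;> simp [Matrix.one_apply, apply_ite φ]

theorem gamma_complex (z : ℂ) :
    G.gamma z = z • G.hamHat - z ^ 2 • internalProj n m ℂ - 1 := by
  rw [gamma_eq]
  congr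

theorem gamma_conjTranspose (z : ℂ) : (G.gamma z)ᴴ = G.gamma (conj z) := by
  have hQ : (internalProj n m ℂ)ᴴ = internalProj n m ℂ := by
    rw [internalProj, Matrix.fromBlocks_conjTranspose]; simp
  rw [gamma_complex, gamma_complex]
  simp [hQ, hamHat_conjTranspose]

noncomputable section

open Polynomial

/-- `det γ` as a polynomial. -/
def detGamma : ℂ[X] := (G.gamma (X : ℂ[X])).det

theorem det_gamma_eq_aeval {R : Type} [CommRing R] [Algebra ℂ R] (z : R) :
    (G.gamma z).det = aeval z G.detGamma := by
  rw [detGamma, AlgHom.map_det]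
  change _ = ((G.gamma X).map (aeval z)).det
  rw [gamma_map, aeval_X]

theorem eval_detGamma (z : ℂ) : G.detGamma.eval z = (G.gamma z).det := by
  rw [det_gamma_eq_aeval, coe_aeval_eq_eval]

theorem eval_zero_detGamma_ne_zero : G.detGamma.eval 0 ≠ 0 := by
  rw [eval_detGamma, gamma_complex]
  simp [Matrix.det_neg]

theorem detGamma_ne_zero : G.detGamma ≠ 0 := fun h =>
  G.eval_zero_detGamma_ne_zero (by simp [h])

/-- The states of the finite graph annihilated by `γ z`. -/
def kernel (z : ℂ) : Submodule ℂ (Fin n ⊕ Fin m → ℂ) := LinearMap.ker (G.gamma z).mulVecLin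

/-- The states of the finite graph annihilated by `γ z` that vanish on the distinguished
vertices. -/
def confKernel (z : ℂ) : Submodule ℂ (Fin n ⊕ Fin m → ℂ) :=
  G.kernel z ⊓ LinearMap.ker (LinearMap.funLeft ℂ ℂ (Sum.inl : Fin n → Fin n ⊕ Fin m))

/-- The states annihilated by `γ z` and orthogonal to the confined ones. -/
def unconfKernel (z : ℂ) : Submodule ℂ (Fin n ⊕ Fin m → ℂ) :=
  G.kernel z ⊓ ⨅ φ ∈ G.confKernel z,
    LinearMap.ker (dotProductBilin ℂ ℂ (star φ) : (Fin n ⊕ Fin m → ℂ) →ₗ[ℂ] ℂ)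

variable {G}

theorem mem_kernel {z : ℂ} {v : Fin n ⊕ Fin m → ℂ} : v ∈ G.kernel z ↔ G.gamma z *ᵥ v = 0 := by
  simp [kernel]

theorem mem_confKernel {z : ℂ} {v : Fin n ⊕ Fin m → ℂ} :
    v ∈ G.confKernel z ↔ G.gamma z *ᵥ v = 0 ∧ ∀ j, v (Sum.inl j) = 0 := by
  simp [confKernel, mem_kernel, funext_iff, LinearMap.funLeft_apply]

theorem mem_unconfKernel {z : ℂ} {v : Fin n ⊕ Fin m → ℂ} :
    v ∈ G.unconfKernel z ↔ G.gamma z *ᵥ v = 0 ∧ ∀ φ ∈ G.confKernel z, star φ ⬝ᵥ v = 0 := by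
  simp [unconfKernel, mem_kernel]

theorem gamma_mulVec (z : ℂ) (v : Fin n ⊕ Fin m → ℂ) :
    G.gamma z *ᵥ v = z • G.hamHat *ᵥ v - z ^ 2 • internalProj n m ℂ *ᵥ v - v := by
  rw [gamma_complex, Matrix.sub_mulVec, Matrix.sub_mulVec, Matrix.smul_mulVec, Matrix.smul_mulVec,
    Matrix.one_mulVec]

theorem internalProj_mulVec (v : Fin n ⊕ Fin m → ℂ) :
    internalProj n m ℂ *ᵥ v = Sum.elim (fun _ => 0) (v ∘ Sum.inr) := by
  rw [internalProj, Matrix.fromBlocks_mulVec]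
  ext (j | i) <;> simp

theorem internalProj_mulVec_eq_self {v : Fin n ⊕ Fin m → ℂ} (hv : ∀ j, v (Sum.inl j) = 0) :
    internalProj n m ℂ *ᵥ v = v := by
  rw [internalProj_mulVec]
  ext (j | i)
  · simp [hv j]
  · rfl

/-- A confined state is an eigenvector of `hamHat`. -/
theorem hamHat_mulVec_of_mem_confKernel {z : ℂ} (hz : z ≠ 0) {v : Fin n ⊕ Fin m → ℂ}
    (hv : v ∈ G.confKernel z) : G.hamHat *ᵥ v = (z + z⁻¹) • v := by
  obtain ⟨h, h0⟩ := mem_confKernel.1 hv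
  rw [gamma_mulVec, internalProj_mulVec_eq_self h0] at h
  have h1 : G.hamHat *ᵥ v = z⁻¹ • (z • G.hamHat *ᵥ v - z ^ 2 • v - v) + (z + z⁻¹) • v := by
    rw [smul_sub, smul_sub, smul_smul, smul_smul, inv_mul_cancel₀ hz,
      show z⁻¹ * z ^ 2 = z by field_simp]
    module
  rw [h1, h, smul_zero, zero_add]

theorem mem_confKernel_of_hamHat_mulVec {z : ℂ} (hz : z ≠ 0) {v : Fin n ⊕ Fin m → ℂ}
    (h0 : ∀ j, v (Sum.inl j) = 0) (h : G.hamHat *ᵥ v = (z + z⁻¹) • v) : v ∈ G.confKernel z := by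
  refine mem_confKernel.2 ⟨?_, h0⟩
  rw [gamma_mulVec, internalProj_mulVec_eq_self h0, h, smul_smul,
    show z * (z + z⁻¹) = z ^ 2 + 1 by field_simp]
  module

theorem confKernel_zero : G.confKernel 0 = ⊥ := by
  rw [eq_bot_iff]
  intro v hv
  have := (mem_confKernel.1 hv).1
  rw [gamma_mulVec] at this
  simpa using this

/-- The confined states depend only on the energy `z + 1/z`. -/
theorem confKernel_inv {z : ℂ} (hz : z ≠ 0) : G.confKernel z⁻¹ = G.confKernel z := by
  have key : ∀ {z : ℂ}, z ≠ 0 → G.confKernel z⁻¹ ≤ G.confKernel z := fun {z} hz v hv =>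
    mem_confKernel_of_hamHat_mulVec hz (mem_confKernel.1 hv).2 (by
      rw [hamHat_mulVec_of_mem_confKernel (inv_ne_zero hz) hv, inv_inv, add_comm])
  refine le_antisymm (key hz) ?_
  have := key (inv_ne_zero hz)
  rwa [inv_inv] at this

/-- The energy balance of a state annihilated by `γ z`. -/
theorem exists_energy {z : ℂ} {v : Fin n ⊕ Fin m → ℂ} (hv : G.gamma z *ᵥ v = 0) :
    ∃ r a b : ℝ, star v ⬝ᵥ (G.hamHat *ᵥ v) = r ∧ star v ⬝ᵥ (internalProj n m ℂ *ᵥ v) = b ∧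
      z * r = a + (1 + z ^ 2) * b ∧ 0 ≤ a ∧ 0 ≤ b ∧ (a = 0 → ∀ j, v (Sum.inl j) = 0) ∧
      (a = 0 → b = 0 → v = 0) := by
  have hsq : ∀ {k : ℕ} (f : Fin k → ℂ), star f ⬝ᵥ f = ((∑ i, ‖f i‖ ^ 2 : ℝ) : ℂ) := by
    intro k f
    simp [dotProduct, Complex.conj_mul']
  have hzero : ∀ {k : ℕ} (f : Fin k → ℂ), ∑ i, ‖f i‖ ^ 2 = 0 → ∀ i, f i = 0 := by
    intro k f h i
    have := (Finset.sum_eq_zero_iff_of_nonneg fun i _ => by positivity).1 h i (Finset.mem_univ i)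
    simpa using this
  have hH : conj (star v ⬝ᵥ (G.hamHat *ᵥ v)) = star v ⬝ᵥ (G.hamHat *ᵥ v) := by
    change star _ = _
    rw [← Matrix.star_dotProduct, Matrix.star_mulVec, ← Matrix.dotProduct_mulVec,
      hamHat_conjTranspose]
  have hb : star v ⬝ᵥ (internalProj n m ℂ *ᵥ v) = ((∑ i, ‖v (Sum.inr i)‖ ^ 2 : ℝ) : ℂ) := by
    rw [internalProj_mulVec, ← hsq fun i => v (Sum.inr i)]
    simp [dotProduct]
  have hab : star v ⬝ᵥ v = ((∑ j, ‖v (Sum.inl j)‖ ^ 2 : ℝ) : ℂ) +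
      ((∑ i, ‖v (Sum.inr i)‖ ^ 2 : ℝ) : ℂ) := by
    rw [← hsq fun i => v (Sum.inr i), ← hsq fun i => v (Sum.inl i)]
    simp [dotProduct]
  obtain ⟨r, hr⟩ := Complex.conj_eq_iff_real.1 hH
  -- `r` is the expectation of the Hermitian `hamHat`; `a` and `b` are the weights of `v` on the
  -- distinguished and on the internal vertices.
  refine ⟨r, ∑ j, ‖v (Sum.inl j)‖ ^ 2, ∑ i, ‖v (Sum.inr i)‖ ^ 2, hr, hb, ?_, by positivity,
    by positivity, hzero fun j => v (Sum.inl j), fun ha hb => ?_⟩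
  · have := congrArg (star v ⬝ᵥ ·) hv
    simp only [gamma_mulVec, dotProduct_sub, dotProduct_smul, smul_eq_mul, dotProduct_zero] at this
    rw [hr, hb, hab] at this
    linear_combination this
  · ext (j | i)
    · exact hzero (fun j => v (Sum.inl j)) ha j
    · exact hzero (fun i => v (Sum.inr i)) hb i

/-- There is no flux through the paths in a state annihilated by `γ z`, unless `z` is real. -/
theorem inl_eq_zero_of_im_ne_zero {z : ℂ} (h1 : ‖z‖ ≤ 1) (hz : z.im ≠ 0)
    {v : Fin n ⊕ Fin m → ℂ} (hv : G.gamma z *ᵥ v = 0) :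
    (∀ j, v (Sum.inl j) = 0) ∧ (‖z‖ < 1 → v = 0) := by
  obtain ⟨r, a, b, -, -, h, ha, hb, ha0, hab⟩ := exists_energy hv
  have hre := congrArg Complex.re h
  have him := congrArg Complex.im h
  simp [pow_two] at hre him
  have hr : r = 2 * z.re * b := by
    apply mul_left_cancel₀ hz
    linear_combination him
  have hn : ‖z‖ ^ 2 = z.re ^ 2 + z.im ^ 2 := by
    rw [← Complex.normSq_eq_norm_sq, Complex.normSq_apply]; ring
  -- The imaginary part of the balance determined `r`; substituting it into the real part leaves a
  -- sum of two nonnegative terms.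
  have key : a + (1 - ‖z‖ ^ 2) * b = 0 := by
    rw [hn]; rw [hr] at hre; linear_combination -hre
  have h2 : 0 ≤ 1 - ‖z‖ ^ 2 := by nlinarith [norm_nonneg z]
  have ha' : a = 0 := by nlinarith [mul_nonneg h2 hb]
  refine ⟨ha0 ha', fun hlt => hab ha' ?_⟩
  have h3 : 0 < 1 - ‖z‖ ^ 2 := by nlinarith [norm_nonneg z]
  rw [ha', zero_add] at key
  exact (mul_eq_zero.1 key).resolve_left h3.ne'

end

end ScatteringGraph

/-! ### Orders of vanishing of `det γ` in the closed unit disk -/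

namespace ScatteringGraph

variable {n m : ℕ} {G : ScatteringGraph n m}

noncomputable section

open Polynomial

variable (G) in
/-- The quotient of `γ X - γ z` by `X - z`. -/
def gammaSlope (z : ℂ) : Matrix (Fin n ⊕ Fin m) (Fin n ⊕ Fin m) ℂ[X] :=
  G.hamHat.map C - (X + C z) • (internalProj n m ℂ).map C

theorem internalProj_map :
    (internalProj n m ℂ).map (C : ℂ → ℂ[X]) = internalProj n m ℂ[X] := by
  rw [internalProj, internalProj]
  ext (i | i) (j | j) <;> simp [Matrix.one_apply, apply_ite C]

theorem gamma_X_eq (z : ℂ) :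
    G.gamma (X : ℂ[X]) = (G.gamma z).map C + (X - C z) • G.gammaSlope z := by
  have h1 : (G.gamma z).map (C : ℂ → ℂ[X]) =
      C z • G.hamHat.map C - (C z) ^ 2 • (internalProj n m ℂ).map C - 1 := by
    rw [gamma_complex]
    ext i j
    simp [Matrix.one_apply, apply_ite C]
  rw [h1, gammaSlope, gamma_eq, ← internalProj_map, Polynomial.algebraMap_eq]
  module

/-- On confined vectors `hamHat` is `z + 1/z` and the internal projection is the identity, so `γ(X)`
acts as `X (z + 1/z) - X² - 1 = -(X - z)(X - 1/z)`. This scalar is split off; the remaining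
determinant is expanded about `z`, with `V Vᴴ` the orthogonal projection onto the confined kernel.
-/
theorem exists_detGamma_deflation {z : ℂ} (hz : z ≠ 0) :
    ∃ V : Matrix (Fin n ⊕ Fin m) (Fin (Module.finrank ℂ (G.confKernel z))) ℂ,
      Vᴴ * V = 1 ∧ (∀ u, V *ᵥ u ∈ G.confKernel z) ∧
      (∀ v ∈ G.confKernel z, V *ᵥ (Vᴴ *ᵥ v) = v) ∧
      G.detGamma = (-((X - C z) * (X - C z⁻¹))) ^ Module.finrank ℂ (G.confKernel z) *
        ((G.gamma z * (1 - V * Vᴴ) + V * Vᴴ).map C +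
          (X - C z) • (G.gammaSlope z * (1 - V * Vᴴ).map C)).det := by
  obtain ⟨V, hV, hmem, hid⟩ := (G.confKernel z).exists_isometry_matrix
  refine ⟨V, hV, hmem, hid, ?_⟩
  have hH : G.hamHat * V = (z + z⁻¹) • V := by
    refine Matrix.ext_of_mulVec_single fun i => ?_
    rw [← Matrix.mulVec_mulVec, hamHat_mulVec_of_mem_confKernel hz (hmem _), Matrix.smul_mulVec]
  have hQ : internalProj n m ℂ * V = V := by
    refine Matrix.ext_of_mulVec_single fun i => ?_
    rw [← Matrix.mulVec_mulVec, internalProj_mulVec_eq_self (mem_confKernel.1 (hmem _)).2]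
  have hHC : G.hamHat.map C * V.map C = C (z + z⁻¹) • V.map (C : ℂ →+* ℂ[X]) := by
    rw [← Matrix.map_mul, hH]
    ext i j
    simp
  have hQC : (internalProj n m ℂ).map C * V.map C = V.map (C : ℂ →+* ℂ[X]) := by
    rw [← Matrix.map_mul, hQ]
  have hf : G.gamma (X : ℂ[X]) * V.map C =
      (-((X - C z) * (X - C z⁻¹))) • V.map (C : ℂ →+* ℂ[X]) := by
    have hzz : C z * C z⁻¹ = (1 : ℂ[X]) := by rw [← C_mul, mul_inv_cancel₀ hz, C_1]
    have e : -((X - C z) * (X - C z⁻¹)) = X * C (z + z⁻¹) - X ^ 2 - 1 := by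
      rw [C_add]; linear_combination -hzz
    rw [e, gamma_eq, ← internalProj_map, Polynomial.algebraMap_eq, Matrix.sub_mul, Matrix.sub_mul,
      Matrix.smul_mul, Matrix.smul_mul, hQC, hHC, Matrix.one_mul]
    module
  have hmap : (V * Vᴴ).map C = V.map C * Vᴴ.map (C : ℂ →+* ℂ[X]) := Matrix.map_mul
  rw [detGamma, Matrix.det_eq_pow_mul_det _ (V.map C) (Vᴴ.map (C : ℂ →+* ℂ[X]))
      (by rw [← Matrix.map_mul, hV]; simp) _ hf, Fintype.card_fin]
  congr 2
  have hsub : (1 - V * Vᴴ).map C = 1 - (V.map C * Vᴴ.map (C : ℂ →+* ℂ[X])) := by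
    rw [Matrix.map_sub _ (fun _ _ => C_sub), Matrix.map_one _ C_0 C_1, hmap]
  have hadd : (G.gamma z * (1 - V * Vᴴ) + V * Vᴴ).map C =
      (G.gamma z).map C * (1 - V * Vᴴ).map C + (V * Vᴴ).map (C : ℂ →+* ℂ[X]) := by
    rw [Matrix.map_add _ (fun _ _ => C_add), Matrix.map_mul]
  rw [hadd, hsub, hmap, gamma_X_eq z, Matrix.add_mul, Matrix.smul_mul]
  abel

theorem eval_gammaSlope (z : ℂ) (A : Matrix (Fin n ⊕ Fin m) (Fin n ⊕ Fin m) ℂ) :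
    (G.gammaSlope z * A.map C).map (eval z) =
      (G.hamHat - (2 * z) • internalProj n m ℂ) * A := by
  have h : (G.gammaSlope z * A.map C).map (evalRingHom z) =
      (G.gammaSlope z).map (evalRingHom z) * (A.map C).map (evalRingHom z) := Matrix.map_mul
  refine h.trans ?_
  congr 1
  · rw [gammaSlope]
    ext i j
    simp [two_mul]
  · ext i j
    simp

/-- The order of vanishing of `det γ` at a nonreal point of the unit circle. -/
theorem rootMultiplicity_of_im_ne_zero {z : ℂ} (h1 : ‖z‖ = 1) (hz : z.im ≠ 0) :
    G.detGamma.rootMultiplicity z = Module.finrank ℂ (G.confKernel z) := by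
  have hz0 : z ≠ 0 := by rintro rfl; simp at hz
  obtain ⟨V, hV, hmem, hid, hdet⟩ := exists_detGamma_deflation (G := G) hz0
  have hinv : z⁻¹ = conj z := by
    rw [Complex.inv_def, Complex.normSq_eq_norm_sq, h1]; simp
  -- On the circle `conj z = 1/z` has the same confined kernel, so confined vectors are also left
  -- null vectors of `γ(z)`.
  have hl : Vᴴ * G.gamma z = 0 := by
    have : G.gamma (conj z) * V = 0 := by
      refine Matrix.ext_of_mulVec_single fun i => ?_
      have := (confKernel_inv hz0).ge (hmem (Pi.single i 1))
      rw [hinv] at this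
      rw [← Matrix.mulVec_mulVec, (mem_confKernel.1 this).1, Matrix.zero_mulVec]
    rw [← gamma_conjTranspose] at this
    have := congrArg Matrix.conjTranspose this
    rwa [Matrix.conjTranspose_mul, Matrix.conjTranspose_conjTranspose,
      Matrix.conjTranspose_zero] at this
  have hr : G.gamma z * V = 0 := by
    refine Matrix.ext_of_mulVec_single fun i => ?_
    rw [← Matrix.mulVec_mulVec, (mem_confKernel.1 (hmem _)).1, Matrix.zero_mulVec]
  set p := ((G.gamma z * (1 - V * Vᴴ) + V * Vᴴ).map C +
          (X - C z) • (G.gammaSlope z * (1 - V * Vᴴ).map C)).det with hp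
  have hp0 : p.eval z ≠ 0 := by
    have he : p.eval z = (G.gamma z + V * Vᴴ).det := by
      rw [hp, ← coe_evalRingHom, RingHom.map_det]
      congr 1
      rw [Matrix.mul_sub, ← Matrix.mul_assoc, hr]
      ext i j
      simp
    rw [he, Ne, ← Matrix.exists_mulVec_eq_zero_iff]
    rintro ⟨v, hv, h0⟩
    have h2 : Vᴴ *ᵥ v = 0 := by
      have := congrArg (Vᴴ *ᵥ ·) h0
      simpa only [Matrix.mulVec_mulVec, Matrix.mul_add, hl, zero_add, ← Matrix.mul_assoc, hV,
        Matrix.one_mul, Matrix.mulVec_zero] using this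
    have h3 : G.gamma z *ᵥ v = 0 := by
      rwa [Matrix.add_mulVec, ← Matrix.mulVec_mulVec v V, h2, Matrix.mulVec_zero, add_zero] at h0
    apply hv
    -- A null vector at a nonreal point of the circle carries no flux, hence is confined; being also
    -- orthogonal to the confined kernel, it vanishes.
    rw [← hid v (mem_confKernel.2 ⟨h3, (inl_eq_zero_of_im_ne_zero h1.le hz h3).1⟩), h2,
      Matrix.mulVec_zero]
  have e : G.detGamma = (X - C z) ^ Module.finrank ℂ (G.confKernel z) *
      ((-(X - C z⁻¹)) ^ Module.finrank ℂ (G.confKernel z) * p) := by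
    rw [hdet, ← mul_assoc, ← mul_pow]
    congr 2
    ring
  rw [e]
  refine rootMultiplicity_X_sub_C_pow_mul ?_ _
  rw [eval_mul, eval_pow]
  refine mul_ne_zero (pow_ne_zero _ ?_) hp0
  simp only [eval_neg, eval_sub, eval_X, eval_C, ne_eq, neg_eq_zero, sub_eq_zero]
  intro h
  rw [hinv] at h
  exact hz (Complex.conj_eq_iff_im.1 h.symm)

/-- After deflation the kernel at `x` is the unconfined one. On it the form of the slope `H - 2xQ`,
times `x`, equals `a + (1 - x²) b` with `a`, `b` the weights on distinguished and internal vertices.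
If this vanishes then `a = 0`, so the vector is confined and therefore zero. Thus the order of
vanishing of the deflated determinant is the dimension of the kernel, at `±1` as well. -/
theorem exists_detGamma_eq_of_real {x : ℝ} (hx : x ≠ 0) (h1 : |x| ≤ 1) :
    ∃ q : ℂ[X], q.eval (x : ℂ) ≠ 0 ∧
      G.detGamma = (-((X - C (x : ℂ)) * (X - C (x : ℂ)⁻¹))) ^
        Module.finrank ℂ (G.confKernel x) *
        ((X - C (x : ℂ)) ^ Module.finrank ℂ (G.unconfKernel x) * q) := by
  have hx0 : (x : ℂ) ≠ 0 := by exact_mod_cast hx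
  obtain ⟨V, hV, hmem, hid, hdet⟩ := exists_detGamma_deflation (G := G) hx0
  obtain ⟨U, hU, hmemU, hidU⟩ := (G.unconfKernel (x : ℂ)).exists_isometry_matrix
  have hherm : (G.gamma (x : ℂ))ᴴ = G.gamma (x : ℂ) := by
    rw [gamma_conjTranspose, Complex.conj_ofReal]
  have hleft : ∀ {k : ℕ} (W : Matrix (Fin n ⊕ Fin m) (Fin k) ℂ),
      (∀ u, G.gamma (x : ℂ) *ᵥ (W *ᵥ u) = 0) → Wᴴ * G.gamma (x : ℂ) = 0 := by
    intro k W hW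
    have : G.gamma (x : ℂ) * W = 0 := by
      refine Matrix.ext_of_mulVec_single fun i => ?_
      rw [← Matrix.mulVec_mulVec, hW, Matrix.zero_mulVec]
    have := congrArg Matrix.conjTranspose this
    rwa [Matrix.conjTranspose_mul, hherm, Matrix.conjTranspose_zero] at this
  have hl := hleft V fun u => (mem_confKernel.1 (hmem u)).1
  have hlU := hleft U fun u => (mem_unconfKernel.1 (hmemU u)).1
  have horth : ∀ v, (∀ φ ∈ G.confKernel (x : ℂ), star φ ⬝ᵥ v = 0) → Vᴴ *ᵥ v = 0 := by
    intro v hv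
    ext i
    have := hv _ (hmem (Pi.single i 1))
    rw [Matrix.star_mulVec, ← Matrix.dotProduct_mulVec] at this
    simpa [Pi.star_single] using this
  have hVU : Vᴴ * U = 0 := by
    refine Matrix.ext_of_mulVec_single fun i => ?_
    rw [← Matrix.mulVec_mulVec, horth _ (mem_unconfKernel.1 (hmemU _)).2, Matrix.zero_mulVec]
  have hUV : Uᴴ * V = 0 := by
    have := congrArg Matrix.conjTranspose hVU
    rwa [Matrix.conjTranspose_mul, Matrix.conjTranspose_conjTranspose,
      Matrix.conjTranspose_zero] at this
  have hnd : ∀ v, (G.gamma (x : ℂ) * (1 - V * Vᴴ) + V * Vᴴ) *ᵥ v = 0 →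
      Uᴴ *ᵥ ((G.gammaSlope (x : ℂ) * (1 - V * Vᴴ).map C).map (eval (x : ℂ)) *ᵥ v) = 0 →
      v = 0 := by
    intro v h0 hs
    have h2 : Vᴴ *ᵥ v = 0 := by
      have := congrArg (Vᴴ *ᵥ ·) h0
      simpa only [Matrix.mulVec_mulVec, Matrix.mul_add, ← Matrix.mul_assoc, hl, Matrix.zero_mul,
        zero_add, hV, Matrix.one_mul, Matrix.mulVec_zero] using this
    have h4 : (1 - V * Vᴴ) *ᵥ v = v := by
      rw [Matrix.sub_mulVec, ← Matrix.mulVec_mulVec v V, h2, Matrix.mulVec_zero, sub_zero,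
        Matrix.one_mulVec]
    have h3 : G.gamma (x : ℂ) *ᵥ v = 0 := by
      rwa [Matrix.add_mulVec, ← Matrix.mulVec_mulVec v V, h2, Matrix.mulVec_zero, add_zero,
        ← Matrix.mulVec_mulVec, h4] at h0
    have hvU : v ∈ G.unconfKernel (x : ℂ) := by
      refine mem_unconfKernel.2 ⟨h3, fun φ hφ => ?_⟩
      rw [← hid φ hφ, Matrix.star_mulVec, ← Matrix.dotProduct_mulVec, h2, dotProduct_zero]
    rw [eval_gammaSlope, ← Matrix.mulVec_mulVec, h4] at hs
    -- As `v` lies in the range of `U`, the compressed equation may be paired with `v` itself.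
    have hs' : star v ⬝ᵥ ((G.hamHat - (2 * (x : ℂ)) • internalProj n m ℂ) *ᵥ v) = 0 := by
      conv_lhs => rw [← hidU v hvU, Matrix.star_mulVec, ← Matrix.dotProduct_mulVec, hidU v hvU, hs,
        dotProduct_zero]
    obtain ⟨r, a, b, hr, hb, h, ha, hb0, ha0, hab⟩ := exists_energy h3
    rw [Matrix.sub_mulVec, Matrix.smul_mulVec, dotProduct_sub, dotProduct_smul, hr, hb,
      smul_eq_mul] at hs'
    norm_cast at hs' h
    have key : a + (1 - x ^ 2) * b = 0 := by linear_combination x * hs' - h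
    have hxs : 0 ≤ 1 - x ^ 2 := by nlinarith [abs_le.1 h1, sq_abs x, abs_nonneg x]
    have ha' : a = 0 := by nlinarith [mul_nonneg hxs hb0]
    have := hid v (mem_confKernel.2 ⟨h3, ha0 ha'⟩)
    rw [← this, h2, Matrix.mulVec_zero]
  have hUM : Uᴴ * (G.gamma (x : ℂ) * (1 - V * Vᴴ) + V * Vᴴ) = 0 := by
    rw [Matrix.mul_add, ← Matrix.mul_assoc, hlU, Matrix.zero_mul, ← Matrix.mul_assoc, hUV,
      Matrix.zero_mul, add_zero]
  have key := Matrix.exists_det_eq_X_sub_C_pow_mul (x : ℂ) _ _ U hU hUM hnd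
  rw [Fintype.card_fin] at key
  obtain ⟨q, hq, hq'⟩ := key
  exact ⟨q, hq, by rw [hdet, hq']⟩

/-- The order of vanishing of `det γ` at a point of `(-1, 1)`. -/
theorem rootMultiplicity_of_abs_lt_one {x : ℝ} (hx : x ≠ 0) (h1 : |x| < 1) :
    G.detGamma.rootMultiplicity (x : ℂ) =
      Module.finrank ℂ (G.confKernel x) + Module.finrank ℂ (G.unconfKernel x) := by
  obtain ⟨q, hq, e⟩ := exists_detGamma_eq_of_real (G := G) hx h1.le
  have e' : G.detGamma = (X - C (x : ℂ)) ^
      (Module.finrank ℂ (G.confKernel x) + Module.finrank ℂ (G.unconfKernel x)) *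
      ((-(X - C (x : ℂ)⁻¹)) ^ Module.finrank ℂ (G.confKernel x) * q) := by
    rw [e, ← mul_neg, mul_pow, pow_add]
    ring
  rw [e']
  refine rootMultiplicity_X_sub_C_pow_mul ?_ _
  rw [eval_mul, eval_pow]
  refine mul_ne_zero (pow_ne_zero _ ?_) hq
  simp only [eval_neg, eval_sub, eval_X, eval_C, ne_eq, neg_eq_zero, sub_eq_zero]
  intro h
  norm_cast at h
  have : x * x = 1 := by nth_rewrite 1 [h]; exact inv_mul_cancel₀ hx
  nlinarith [abs_nonneg x, sq_abs x]

/-- The order of vanishing of `det γ` at `1` and at `-1`. -/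
theorem rootMultiplicity_of_sq_eq_one {x : ℝ} (hx : x ^ 2 = 1) :
    G.detGamma.rootMultiplicity (x : ℂ) =
      2 * Module.finrank ℂ (G.confKernel x) + Module.finrank ℂ (G.unconfKernel x) := by
  have hx0 : x ≠ 0 := by rintro rfl; simp at hx
  obtain ⟨q, hq, e⟩ := exists_detGamma_eq_of_real (G := G) hx0 (by rw [← sq_le_one_iff_abs_le_one, hx])
  have hinv : (x : ℂ)⁻¹ = x := by
    refine inv_eq_of_mul_eq_one_right ?_
    norm_cast
    rw [← hx, pow_two]
  -- Since `1/x = x`, the two factors of the confined scalar coincide, which doubles the confined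
  -- contribution.
  have e' : G.detGamma = (X - C (x : ℂ)) ^
      (2 * Module.finrank ℂ (G.confKernel x) + Module.finrank ℂ (G.unconfKernel x)) *
      ((-1) ^ Module.finrank ℂ (G.confKernel x) * q) := by
    rw [e, hinv, neg_eq_neg_one_mul, mul_pow, pow_add, pow_mul, pow_two]
    ring
  rw [e']
  refine rootMultiplicity_X_sub_C_pow_mul ?_ _
  rw [eval_mul, eval_pow]
  refine mul_ne_zero (pow_ne_zero _ ?_) hq
  simp

end

end ScatteringGraph

/-! ### The S-matrix and its determinant -/

namespace ScatteringGraph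

variable {n m : ℕ} {G : ScatteringGraph n m}

noncomputable section

open Polynomial

variable (G) in
/-- `-γ(z)⁻¹ γ(1/z)`. -/
def fullScattering {K : Type} [Field K] [Algebra ℂ K] (z : K) :
    Matrix (Fin n ⊕ Fin m) (Fin n ⊕ Fin m) K :=
  -((G.gamma z)⁻¹ * G.gamma z⁻¹)

variable (G) in
/-- The numerator of `-γ(z)⁻¹ γ(1/z)` over the denominator `z² det γ(z)`. -/
def scatteringNumerator {R : Type} [CommRing R] [Algebra ℂ R] (z : R) :
    Matrix (Fin n ⊕ Fin m) (Fin n ⊕ Fin m) R :=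
  -((G.gamma z).adjugate * (G.gamma z - (z ^ 2 - 1) • (1 - internalProj n m R)))

/-- The internal equations depend only on the energy, so `γ(z)` and `z² γ(1/z)` differ only in the
distinguished diagonal block. -/
theorem sq_smul_gamma_inv {K : Type} [Field K] [Algebra ℂ K] {z : K} (hz : z ≠ 0) :
    z ^ 2 • G.gamma z⁻¹ = G.gamma z - (z ^ 2 - 1) • (1 - internalProj n m K) := by
  rw [gamma_eq, gamma_eq, smul_sub, smul_sub, smul_smul, smul_smul, inv_pow,
    mul_inv_cancel₀ (pow_ne_zero 2 hz), show z ^ 2 * z⁻¹ = z by field_simp]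
  module

theorem fullScattering_eq {K : Type} [Field K] [Algebra ℂ K] {z : K} (hz : z ≠ 0) :
    G.fullScattering z = (z ^ 2 * (G.gamma z).det)⁻¹ • G.scatteringNumerator z := by
  rw [fullScattering, scatteringNumerator, ← sq_smul_gamma_inv hz, Matrix.inv_def,
    Ring.inverse_eq_inv', Matrix.smul_mul, Matrix.mul_smul, smul_neg, smul_smul, mul_inv,
    mul_comm (z ^ 2)⁻¹, mul_assoc, inv_mul_cancel₀ (pow_ne_zero 2 hz), mul_one]

theorem scatteringNumerator_map {R S : Type} [CommRing R] [Algebra ℂ R] [CommRing S] [Algebra ℂ S]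
    (φ : R →ₐ[ℂ] S) (z : R) :
    (G.scatteringNumerator z).map φ = G.scatteringNumerator (φ z) := by
  have h : ∀ A : Matrix (Fin n ⊕ Fin m) (Fin n ⊕ Fin m) R,
      A.map φ = (φ : R →+* S).mapMatrix A := fun _ => rfl
  have hQ : (φ : R →+* S).mapMatrix (internalProj n m R) = internalProj n m S := by
    rw [internalProj, internalProj]
    ext (i | i) (j | j) <;> simp [Matrix.one_apply, apply_ite φ]
  have hs : ∀ (a : R) (A : Matrix (Fin n ⊕ Fin m) (Fin n ⊕ Fin m) R),
      (φ : R →+* S).mapMatrix (a • A) = φ a • (φ : R →+* S).mapMatrix A := fun a A => by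
    ext; simp
  have hg : (φ : R →+* S).mapMatrix (G.gamma z) = G.gamma (φ z) := gamma_map G φ z
  rw [h, scatteringNumerator, map_neg, map_mul, RingHom.map_adjugate, map_sub, hg, hs, map_sub,
    map_sub, hQ, map_one, map_one, map_pow]
  rfl

theorem gamma_ratFunc_X_det :
    (G.gamma (RatFunc.X : RatFunc ℂ)).det = algebraMap _ (RatFunc ℂ) G.detGamma := by
  rw [det_gamma_eq_aeval, RatFunc.aeval_X_left_eq_algebraMap]

/-- The adjugate writes every entry as a polynomial over `z² det γ(z)`, a fraction that can be
evaluated wherever its denominator is nonzero. -/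
theorem sMatrix_map_eval {z : ℂ} (hz : z ≠ 0) (hd : (G.gamma z).det ≠ 0) :
    G.sMatrix.map (RatFunc.eval (RingHom.id ℂ) z) = (G.fullScattering z).toBlocks₁₁ := by
  ext i j
  have hN : G.scatteringNumerator (RatFunc.X : RatFunc ℂ) =
      (G.scatteringNumerator (X : ℂ[X])).map (algebraMap _ (RatFunc ℂ)) := by
    have := scatteringNumerator_map (G := G) (IsScalarTower.toAlgHom ℂ ℂ[X] (RatFunc ℂ)) X
    rw [IsScalarTower.coe_toAlgHom', RatFunc.algebraMap_X] at this
    exact this.symm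
  have hS : G.sMatrix i j = algebraMap _ (RatFunc ℂ)
      (G.scatteringNumerator (X : ℂ[X]) (Sum.inl i) (Sum.inl j)) /
        algebraMap _ (RatFunc ℂ) (X ^ 2 * G.detGamma) := by
    change G.fullScattering (RatFunc.X : RatFunc ℂ) (Sum.inl i) (Sum.inl j) = _
    rw [fullScattering_eq RatFunc.X_ne_zero, hN, gamma_ratFunc_X_det, map_mul, map_pow,
      RatFunc.algebraMap_X, Matrix.smul_apply, Matrix.map_apply, smul_eq_mul, div_eq_inv_mul]
  have he : (X ^ 2 * G.detGamma).eval z = z ^ 2 * (G.gamma z).det := by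
    rw [eval_mul, eval_pow, eval_X, eval_detGamma]
  have hNz : eval z (G.scatteringNumerator (X : ℂ[X]) (Sum.inl i) (Sum.inl j)) =
      G.scatteringNumerator z (Sum.inl i) (Sum.inl j) := by
    have := congrFun (congrFun (scatteringNumerator_map (G := G) (aeval z) X) (Sum.inl i))
      (Sum.inl j)
    rwa [aeval_X, Matrix.map_apply, coe_aeval_eq_eval] at this
  rw [Matrix.map_apply, hS, RatFunc.eval_algebraMap_div _ _
    (by rw [he]; exact mul_ne_zero (pow_ne_zero 2 hz) hd), he, hNz]
  change _ = G.fullScattering z (Sum.inl i) (Sum.inl j)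
  rw [fullScattering_eq hz, Matrix.smul_apply, smul_eq_mul, div_eq_inv_mul]

/-- By `sq_smul_gamma_inv`, the full matrix is `-z⁻²` times the identity up to a term supported in
the distinguished columns. It is thus block triangular, and its determinant is `det S` times
`(-z⁻²)^m`. -/
theorem det_fullScattering_block {K : Type} [Field K] [Algebra ℂ K] {z : K} (hz : z ≠ 0)
    (hd : (G.gamma z).det ≠ 0) :
    (G.fullScattering z).toBlocks₁₁.det =
      (-1) ^ n * z ^ (2 * m) * ((G.gamma z⁻¹).det / (G.gamma z).det) := by
  have hu : IsUnit (G.gamma z).det := isUnit_iff_ne_zero.2 hd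
  have hT : G.fullScattering z = -(z⁻¹) ^ 2 • (1 - (z ^ 2 - 1) •
      ((G.gamma z)⁻¹ * (1 - internalProj n m K))) := by
    have h : G.gamma z⁻¹ = (z⁻¹) ^ 2 • (z ^ 2 • G.gamma z⁻¹) := by
      rw [smul_smul, ← mul_pow, inv_mul_cancel₀ hz, one_pow, one_smul]
    rw [fullScattering, h, sq_smul_gamma_inv hz, Matrix.mul_smul, Matrix.mul_sub,
      Matrix.nonsing_inv_mul _ hu, Matrix.mul_smul, neg_smul]
  have hQ : (1 : Matrix (Fin n ⊕ Fin m) (Fin n ⊕ Fin m) K) - internalProj n m K =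
      Matrix.fromBlocks 1 0 0 0 := by
    rw [internalProj, ← Matrix.fromBlocks_one]
    ext (i | i) (j | j) <;> simp [Matrix.one_apply]
  have h0 : ∀ i j, ((G.gamma z)⁻¹ * (1 - internalProj n m K)) i (Sum.inr j) = 0 := by
    intro i j
    rw [hQ, Matrix.mul_apply]
    simp
  have h12 : (G.fullScattering z).toBlocks₁₂ = 0 := by
    ext i j
    rw [hT]
    simp [Matrix.toBlocks₁₂, h0]
  have h22 : (G.fullScattering z).toBlocks₂₂ = (-(z⁻¹) ^ 2) • 1 := by
    ext i j
    rw [hT]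
    simp [Matrix.toBlocks₂₂, h0, Matrix.one_apply]
  have hdet : (G.fullScattering z).det =
      (G.fullScattering z).toBlocks₁₁.det * (-(z⁻¹) ^ 2) ^ m := by
    conv_lhs => rw [← Matrix.fromBlocks_toBlocks (G.fullScattering z), h12,
      Matrix.det_fromBlocks_zero₁₂, h22, Matrix.det_smul, Matrix.det_one, mul_one, Fintype.card_fin]
  have hdet' : (G.fullScattering z).det =
      (-1) ^ n * (-1) ^ m * ((G.gamma z⁻¹).det / (G.gamma z).det) := by
    rw [fullScattering, Matrix.det_neg, Matrix.det_mul, Matrix.det_nonsing_inv,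
      Ring.inverse_eq_inv', Fintype.card_sum, Fintype.card_fin, Fintype.card_fin, pow_add]
    ring
  have hm : (-(z⁻¹) ^ 2) ^ m * ((-1) ^ m * z ^ (2 * m)) = 1 := by
    rw [pow_mul, ← mul_pow, ← mul_pow]
    rw [show -z⁻¹ ^ 2 * (-1 * z ^ 2) = 1 by field_simp, one_pow]
  have hmm : ((-1 : K) ^ m) * (-1) ^ m = 1 := by rw [← mul_pow]; simp
  calc (G.fullScattering z).toBlocks₁₁.det
      = (G.fullScattering z).toBlocks₁₁.det * ((-(z⁻¹) ^ 2) ^ m * ((-1) ^ m * z ^ (2 * m))) := by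
        rw [hm, mul_one]
    _ = (G.fullScattering z).det * ((-1) ^ m * z ^ (2 * m)) := by rw [hdet]; ring
    _ = _ := by rw [hdet']; linear_combination ((-1) ^ n * z ^ (2 * m) *
        ((G.gamma z⁻¹).det / (G.gamma z).det)) * hmm

/-- Conjugating the coefficients transposes `γ(X)`, because `hamHat` is Hermitian. -/
theorem detGamma_map_conj : G.detGamma.map (starRingEnd ℂ) = G.detGamma := by
  have h : (mapRingHom (starRingEnd ℂ)).mapMatrix (G.gamma (X : ℂ[X])) = (G.gamma (X : ℂ[X]))ᵀ := by
    have hw : ∀ u v, conj (G.hamHat u v) = G.hamHat v u := fun u v => (G.weight_symm _ _).symm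
    rw [gamma_eq, internalProj]
    ext (i | i) (j | j) : 2 <;>
      simp [hw, Matrix.one_apply, apply_ite (Polynomial.map (starRingEnd ℂ)), eq_comm]
  have := RingHom.map_det (mapRingHom (starRingEnd ℂ)) (G.gamma (X : ℂ[X]))
  rwa [h, Matrix.det_transpose] at this

theorem roots_detGamma_map_conj :
    G.detGamma.roots.map (starRingEnd ℂ) = G.detGamma.roots := by
  have := (IsAlgClosed.splits G.detGamma).roots_map (starRingEnd ℂ)
  rw [detGamma_map_conj] at this
  exact this.symm

/-- The winding number of `det S`, in terms of the zeros of `det γ`. -/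
theorem hasWinding_det_sMatrix :
    G.sMatrix.det.HasWinding (2 * m - 2 * G.detGamma.roots.countP (‖·‖ < 1) -
      G.detGamma.roots.countP (‖·‖ = 1)) := by
  have hS : G.sMatrix.det = RatFunc.C ((-1) ^ n) * RatFunc.X ^ (2 * m) *
      (G.detGamma.roots.map fun ζ =>
        (RatFunc.X⁻¹ - RatFunc.C (conj ζ)) / (RatFunc.X - RatFunc.C ζ)).prod := by
    have hlead : RatFunc.C G.detGamma.leadingCoeff ≠ 0 := by
      rw [Ne, map_eq_zero, leadingCoeff_eq_zero]
      exact G.detGamma_ne_zero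
    have hprod := (IsAlgClosed.splits G.detGamma).eq_prod_roots
    have hp : ∀ r : RatFunc ℂ, aeval r G.detGamma = RatFunc.C G.detGamma.leadingCoeff *
        (G.detGamma.roots.map fun ζ => r - RatFunc.C ζ).prod := fun r => by
      conv_lhs => rw [hprod]
      rw [map_mul, aeval_C, map_multiset_prod, Multiset.map_map]
      simp
    -- Conjugating the roots of the numerator pairs every factor with its reflection; without this,
    -- single factors could have poles on the circle.
    have hconj : (G.detGamma.roots.map fun ζ => (RatFunc.X⁻¹ : RatFunc ℂ) - RatFunc.C ζ) =
        G.detGamma.roots.map fun ζ => RatFunc.X⁻¹ - RatFunc.C (conj ζ) := by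
      conv_lhs => rw [← roots_detGamma_map_conj, Multiset.map_map]
      rfl
    change (G.fullScattering (RatFunc.X : RatFunc ℂ)).toBlocks₁₁.det = _
    rw [det_fullScattering_block RatFunc.X_ne_zero (by
      rw [gamma_ratFunc_X_det]; exact RatFunc.algebraMap_ne_zero G.detGamma_ne_zero),
      det_gamma_eq_aeval, det_gamma_eq_aeval, hp, hp, mul_div_mul_left _ _ hlead, hconj,
      Multiset.prod_map_div, map_pow, map_neg, map_one]
  rw [hS]
  convert ((RatFunc.HasWinding.C (c := (-1) ^ n) (by simp)).mul
    (RatFunc.HasWinding.X.pow (2 * m))).mul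
    (RatFunc.HasWinding.multiset_reflection G.detGamma.roots) using 1
  push_cast
  ring

/-- Split the restriction of a scattering state into an incoming part `z⁻¹ e` and an outgoing part
`z χ`. The recurrence on the paths then holds automatically, and the eigenvalue equation on the
finite graph becomes `γ(z) χ + γ(1/z) e = 0`. -/
theorem isScatteringMatrix_iff_exists {z : ℂ} (hz : z ≠ 0) (S₀ : Matrix (Fin n) (Fin n) ℂ) :
    G.IsScatteringMatrix z S₀ ↔ ∀ j, ∃ χ : Fin n ⊕ Fin m → ℂ, (∀ j', χ (Sum.inl j') = S₀ j' j) ∧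
      G.gamma z *ᵥ χ + G.gamma z⁻¹ *ᵥ Pi.single (Sum.inl j) 1 = 0 := by
  refine forall_congr' fun j => ?_
  set e : Fin n ⊕ Fin m → ℂ := Pi.single (Sum.inl j) 1 with he
  have hel : ∀ j', e (Sum.inl j') = if j' = j then 1 else 0 := fun j' => by
    simp [he, Pi.single_apply]
  have her : ∀ i, e (Sum.inr i) = 0 := fun i => by simp [he]
  have hl : ∀ (χ : Fin n ⊕ Fin m → ℂ) j', (G.gamma z *ᵥ χ + G.gamma z⁻¹ *ᵥ e) (Sum.inl j') =
      (G.hamHat *ᵥ (z⁻¹ • e + z • χ)) (Sum.inl j') - χ (Sum.inl j') - e (Sum.inl j') := by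
    intro χ j'
    rw [gamma_mulVec, gamma_mulVec, internalProj_mulVec, internalProj_mulVec, Matrix.mulVec_add,
      Matrix.mulVec_smul, Matrix.mulVec_smul]
    simp
    ring
  have hr : ∀ (χ : Fin n ⊕ Fin m → ℂ) i, (G.gamma z *ᵥ χ + G.gamma z⁻¹ *ᵥ e) (Sum.inr i) =
      (G.hamHat *ᵥ (z⁻¹ • e + z • χ)) (Sum.inr i) - (z ^ 2 + 1) * χ (Sum.inr i) := by
    intro χ i
    rw [gamma_mulVec, gamma_mulVec, internalProj_mulVec, internalProj_mulVec, Matrix.mulVec_add,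
      Matrix.mulVec_smul, Matrix.mulVec_smul]
    simp [her]
    ring
  constructor
  · rintro ⟨sc, hsc, hH⟩
    -- The attachment vertex is `x = 1`, with amplitude `z⁻¹ δ + z S₀`; the internal amplitudes are
    -- rescaled to match the factor `z`.
    let χ : Fin n ⊕ Fin m → ℂ := Sum.elim (fun j' => S₀ j' j) fun i => z⁻¹ * sc (.internal i)
    have hhat : sc.hat = z⁻¹ • e + z • χ := by
      ext (j' | i)
      · simp [GraphState.hat, χ, hsc, hel]
      · simp [GraphState.hat, χ, her, mul_inv_cancel_left₀ hz]
    refine ⟨χ, fun _ => rfl, ?_⟩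
    ext (j' | i)
    · have h := congrFun hH (.path 0 j')
      simp only [ham, Pi.smul_apply, smul_eq_mul, hsc, hhat] at h
      rw [hl, hel, Pi.zero_apply]
      simp only [χ, Sum.elim_inl] at h ⊢
      have h2 := mul_inv_cancel₀ hz
      linear_combination h + ((if j' = j then 1 else 0) + S₀ j' j) * h2
    · have h := congrFun hH (.internal i)
      simp only [ham, Pi.smul_apply, smul_eq_mul, hhat] at h
      rw [hr, Pi.zero_apply, h]
      simp only [χ, Sum.elim_inr]
      field_simp
      ring
  · rintro ⟨χ, hχ, h⟩
    let sc : GraphState n m := fun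
      | .path x j' => (z⁻¹) ^ (x + 1) * (if j' = j then 1 else 0) + z ^ (x + 1) * S₀ j' j
      | .internal i => z * χ (Sum.inr i)
    have hhat : sc.hat = z⁻¹ • e + z • χ := by
      ext (j' | i)
      · simp [GraphState.hat, sc, hχ, hel]
      · simp [GraphState.hat, sc, her]
    have h2 := mul_inv_cancel₀ hz
    refine ⟨sc, fun _ _ => rfl, ?_⟩
    ext v
    rcases v with ⟨x, j'⟩ | i
    · rcases x with _ | x
      · have h' := congrFun h (Sum.inl j')
        rw [hl, hel, hχ, Pi.zero_apply] at h'
        simp only [ham, Pi.smul_apply, smul_eq_mul, hhat]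
        simp only [sc]
        linear_combination h' - ((if j' = j then 1 else 0) + S₀ j' j) * h2
      · simp only [ham, Pi.smul_apply, smul_eq_mul, sc]
        linear_combination -((z⁻¹) ^ (x + 1) * (if j' = j then 1 else 0) +
          z ^ (x + 1) * S₀ j' j) * h2
    · have h' := congrFun h (Sum.inr i)
      rw [hr, Pi.zero_apply] at h'
      simp only [ham, Pi.smul_apply, smul_eq_mul, hhat]
      simp only [sc]
      linear_combination h' - χ (Sum.inr i) * h2

theorem isScatteringMatrix_iff {z : ℂ} (hz : z ≠ 0) (hd : (G.gamma z).det ≠ 0)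
    (S₀ : Matrix (Fin n) (Fin n) ℂ) :
    G.IsScatteringMatrix z S₀ ↔ S₀ = (G.fullScattering z).toBlocks₁₁ := by
  have hu : IsUnit (G.gamma z).det := isUnit_iff_ne_zero.2 hd
  have key : ∀ (j : Fin n) (χ : Fin n ⊕ Fin m → ℂ),
      G.gamma z *ᵥ χ + G.gamma z⁻¹ *ᵥ Pi.single (Sum.inl j) 1 = 0 ↔
        χ = G.fullScattering z *ᵥ Pi.single (Sum.inl j) 1 := by
    intro j χ
    rw [fullScattering, Matrix.neg_mulVec, ← Matrix.mulVec_mulVec]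
    constructor
    · intro h
      rw [← neg_eq_of_add_eq_zero_right h, Matrix.mulVec_neg, neg_neg, Matrix.mulVec_mulVec,
        Matrix.nonsing_inv_mul _ hu, Matrix.one_mulVec]
    · rintro rfl
      rw [Matrix.mulVec_neg, Matrix.mulVec_mulVec, Matrix.mul_nonsing_inv _ hu, Matrix.one_mulVec,
        neg_add_cancel]
  rw [isScatteringMatrix_iff_exists hz]
  simp only [key]
  constructor
  · intro h
    ext j' j
    obtain ⟨χ, h1, h2⟩ := h j
    rw [← h1, h2, Matrix.mulVec_single_one]
    rfl
  · rintro rfl j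
    refine ⟨_, fun j' => ?_, rfl⟩
    rw [Matrix.mulVec_single_one]
    rfl

end

end ScatteringGraph

/-! ### States of the infinite graph as vectors on the finite graph -/

/-- The state with restriction `v` to the finite graph that is geometric, of ratio `z`, on the
paths. -/
def GraphState.extend {n m : ℕ} (z : ℂ) : (Fin n ⊕ Fin m → ℂ) →ₗ[ℂ] GraphState n m where
  toFun v
    | .path x j => v (Sum.inl j) * z ^ x
    | .internal i => v (Sum.inr i)
  map_add' v w := by
    ext (⟨x, j⟩ | i)
    · exact add_mul _ _ _
    · rfl
  map_smul' c v := by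
    ext (⟨x, j⟩ | i)
    · exact mul_assoc _ _ _
    · rfl

namespace GraphState

variable {n m : ℕ}

@[simp]
theorem hat_extend (z : ℂ) (v : Fin n ⊕ Fin m → ℂ) : (extend z v).hat = v := by
  ext (j | i)
  · simp [hat, extend]
  · rfl

theorem extend_injective (z : ℂ) :
    Function.Injective (extend z : (Fin n ⊕ Fin m → ℂ) →ₗ[ℂ] GraphState n m) :=
  Function.LeftInverse.injective (hat_extend z)

theorem finrank_map_extend (z : ℂ) (K : Submodule ℂ (Fin n ⊕ Fin m → ℂ)) :
    Module.finrank ℂ ↥(K.map (extend z)) = Module.finrank ℂ K :=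
  (Submodule.equivMapOfInjective _ (extend_injective z) K).finrank_eq.symm

theorem extend_hat {z : ℂ} {ψ : GraphState n m} (h : ∀ x j, ψ (.path x j) = ψ (.path 0 j) * z ^ x) :
    extend z ψ.hat = ψ := by
  ext (⟨x, j⟩ | i)
  · exact (h x j).symm
  · rfl

end GraphState

namespace ScatteringGraph

variable {n m : ℕ} {G : ScatteringGraph n m}

noncomputable section

open Polynomial

theorem mem_solutionSpace_iff {z : ℂ} {ψ : GraphState n m} : ψ ∈ G.solutionSpace z ↔
    (∀ x j, ψ (.path x j) = ψ (.path 0 j) * z ^ x) ∧ ψ.hat ∈ G.kernel z := by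
  rw [mem_kernel]; rfl

/-- A confined state is determined by its restriction; the ratio on the paths is immaterial, as the
amplitude at the attachment vertices is zero. -/
theorem confinedSpan_eq_map (Z : Set ℂ) :
    G.confinedSpan Z = (⨆ z ∈ Z, G.confKernel z).map (GraphState.extend 0) := by
  refine le_antisymm (Submodule.span_le.2 ?_) ?_
  · rintro ψ ⟨h0, z, hz, h⟩
    refine ⟨ψ.hat, ?_, GraphState.extend_hat fun x j => by simp [h0]⟩
    exact (le_iSup₂_of_le z hz le_rfl : G.confKernel z ≤ _) (mem_confKernel.2 ⟨h, fun j => h0 0 j⟩)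
  · rw [Submodule.map_le_iff_le_comap]
    refine iSup₂_le fun z hz v hv => Submodule.subset_span ⟨fun x j => ?_, z, hz, ?_⟩
    · simp [GraphState.extend, (mem_confKernel.1 hv).2 j]
    · rw [GraphState.hat_extend]
      exact (mem_confKernel.1 hv).1

theorem mem_orth_confinedSpan_iff {Z : Set ℂ} {ψ : GraphState n m} :
    ψ ∈ orth (G.confinedSpan Z) ↔ ∀ z ∈ Z, ∀ φ ∈ G.confKernel z, star φ ⬝ᵥ ψ.hat = 0 := by
  change (∀ φ ∈ G.confinedSpan Z, star φ.hat ⬝ᵥ ψ.hat = 0) ↔ _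
  rw [confinedSpan_eq_map]
  constructor
  · intro h z hz φ hφ
    have := h _ ⟨φ, (le_iSup₂_of_le z hz le_rfl : G.confKernel z ≤ _) hφ, rfl⟩
    rwa [GraphState.hat_extend] at this
  · rintro h _ ⟨φ, hφ, rfl⟩
    rw [GraphState.hat_extend]
    -- The pairing is conjugate-linear in `φ`; its conjugate is linear, so its kernel is a complex
    -- subspace.
    let L : Submodule ℂ (Fin n ⊕ Fin m → ℂ) :=
      LinearMap.ker (dotProductBilin ℂ ℂ (star ψ.hat) : (Fin n ⊕ Fin m → ℂ) →ₗ[ℂ] ℂ)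
    have hL : ∀ v, v ∈ L ↔ star v ⬝ᵥ ψ.hat = 0 := fun v => by
      change star ψ.hat ⬝ᵥ v = 0 ↔ _
      rw [← star_eq_zero, ← Matrix.star_dotProduct_star, star_star, dotProduct_comm]
    have hle : ⨆ z ∈ Z, G.confKernel z ≤ L := iSup₂_le fun z hz v hv => (hL v).2 (h z hz v hv)
    exact (hL φ).1 (hle hφ)

/-- States annihilated by `γ x`, with `x` real, are orthogonal to the confined states of another
energy. -/
theorem star_dotProduct_eq_zero_or_mem_confKernel {x : ℝ} {z : ℂ} {v φ : Fin n ⊕ Fin m → ℂ}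
    (hv : v ∈ G.kernel x) (hφ : φ ∈ G.confKernel z) :
    star φ ⬝ᵥ v = 0 ∨ φ ∈ G.confKernel x := by
  rcases eq_or_ne z 0 with rfl | hz
  · rw [confKernel_zero, Submodule.mem_bot] at hφ
    simp [hφ]
  have hγ : G.gamma (x : ℂ) *ᵥ φ = (x * (z + z⁻¹) - x ^ 2 - 1) • φ := by
    rw [gamma_mulVec, internalProj_mulVec_eq_self (mem_confKernel.1 hφ).2,
      hamHat_mulVec_of_mem_confKernel hz hφ]
    module
  by_cases hc : x * (z + z⁻¹) - (x : ℂ) ^ 2 - 1 = 0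
  · exact Or.inr (mem_confKernel.2 ⟨by rw [hγ, hc, zero_smul], (mem_confKernel.1 hφ).2⟩)
  · left
    -- `γ(x)` is Hermitian and can be moved from its eigenvector `φ` onto `v`, which it annihilates.
    have h : star (G.gamma (x : ℂ) *ᵥ φ) ⬝ᵥ v = 0 := by
      rw [Matrix.star_mulVec, gamma_conjTranspose, Complex.conj_ofReal, ← Matrix.dotProduct_mulVec,
        mem_kernel.1 hv, dotProduct_zero]
    rw [hγ, star_smul, smul_dotProduct, smul_eq_mul] at h
    exact (mul_eq_zero.1 h).resolve_left (mt star_eq_zero.1 hc)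

/-- Orthogonality to confined states of other energies is automatic, so only the confined states at
`x` itself impose a condition. -/
theorem finrank_solutionSpace_inf_orth {x : ℝ} {Z : Set ℂ} (hx : (x : ℂ) ∈ Z) :
    Module.finrank ℂ ↥(G.solutionSpace x ⊓ orth (G.confinedSpan Z)) =
      Module.finrank ℂ (G.unconfKernel x) := by
  have h : G.solutionSpace x ⊓ orth (G.confinedSpan Z) =
      (G.unconfKernel x).map (GraphState.extend (x : ℂ)) := by
    ext ψ
    rw [Submodule.mem_inf, mem_solutionSpace_iff, mem_orth_confinedSpan_iff]
    constructor
    · rintro ⟨⟨h1, h2⟩, h3⟩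
      exact ⟨ψ.hat, mem_unconfKernel.2 ⟨mem_kernel.1 h2, h3 _ hx⟩, GraphState.extend_hat h1⟩
    · rintro ⟨v, hv, rfl⟩
      obtain ⟨h1, h2⟩ := mem_unconfKernel.1 hv
      rw [GraphState.hat_extend]
      refine ⟨⟨fun y j => by simp [GraphState.extend], mem_kernel.2 h1⟩, fun z _ φ hφ => ?_⟩
      exact (star_dotProduct_eq_zero_or_mem_confKernel (mem_kernel.2 h1) hφ).elim id (h2 φ)
  rw [h, GraphState.finrank_map_extend]

theorem mem_roots_of_mem_kernel {z : ℂ} {v : Fin n ⊕ Fin m → ℂ} (hv : v ∈ G.kernel z)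
    (h0 : v ≠ 0) : z ∈ G.detGamma.roots := by
  rw [mem_roots G.detGamma_ne_zero, IsRoot, eval_detGamma]
  exact Matrix.exists_mulVec_eq_zero_iff.1 ⟨v, h0, mem_kernel.1 hv⟩

theorem confKernel_eq_bot {z : ℂ} (hz : z ∉ G.detGamma.roots) : G.confKernel z = ⊥ := by
  rw [eq_bot_iff]
  intro v hv
  by_contra h0
  exact hz (mem_roots_of_mem_kernel (mem_kernel.2 (mem_confKernel.1 hv).1) h0)

theorem ne_zero_of_mem_roots {z : ℂ} (hz : z ∈ G.detGamma.roots) : z ≠ 0 := by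
  rintro rfl
  exact G.eval_zero_detGamma_ne_zero ((mem_roots G.detGamma_ne_zero).1 hz)

/-- The zeros of `det γ` in the open unit disk are real. -/
theorem im_eq_zero_of_mem_roots {z : ℂ} (hz : z ∈ G.detGamma.roots) (h1 : ‖z‖ < 1) : z.im = 0 := by
  by_contra him
  rw [mem_roots G.detGamma_ne_zero, IsRoot, eval_detGamma] at hz
  obtain ⟨v, hv, h⟩ := Matrix.exists_mulVec_eq_zero_iff.2 hz
  exact hv ((inl_eq_zero_of_im_ne_zero h1.le him h).2 h1)

/-! ### Counting the roots of `det γ` by the bound states -/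

variable (G) in
/-- The zeros of `det γ` in the open unit disk. -/
def rootsInside : Finset ℂ := G.detGamma.roots.toFinset.filter (‖·‖ < 1)

variable (G) in
/-- The zeros of `det γ` on the open upper half of the unit circle. -/
def rootsUpper : Finset ℂ := G.detGamma.roots.toFinset.filter fun z => ‖z‖ = 1 ∧ 0 < z.im

theorem mem_rootsInside {z : ℂ} :
    z ∈ G.rootsInside ↔ z ∈ G.detGamma.roots ∧ ‖z‖ < 1 := by
  simp only [rootsInside, Finset.mem_filter, Multiset.mem_toFinset]

theorem mem_rootsUpper {z : ℂ} :
    z ∈ G.rootsUpper ↔ z ∈ G.detGamma.roots ∧ ‖z‖ = 1 ∧ 0 < z.im := by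
  simp only [rootsUpper, Finset.mem_filter, Multiset.mem_toFinset]

theorem eq_one_or_neg_one_of_im_eq_zero {z : ℂ} (h1 : ‖z‖ = 1) (him : z.im = 0) :
    z = 1 ∨ z = -1 := by
  have hz : z = (z.re : ℂ) := Complex.ext rfl him
  rw [hz, Complex.norm_real, Real.norm_eq_abs] at h1
  rw [hz]
  rcases eq_or_eq_neg_of_abs_eq h1 with h | h <;> simp [h]

theorem inv_eq_conj_of_norm_eq_one {z : ℂ} (h1 : ‖z‖ = 1) : z⁻¹ = conj z := by
  rw [Complex.inv_def, Complex.normSq_eq_norm_sq, h1]; simp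

variable (G) in
/-- Representatives of the energies of the confined states. -/
def confParams : Finset ℂ := G.rootsInside ∪ (G.rootsUpper ∪ {1, -1})

theorem mem_confParams {z : ℂ} (hz : z ∈ G.confParams) :
    z ≠ 0 ∧ ‖z‖ ≤ 1 ∧ (‖z‖ = 1 → 0 ≤ z.im) := by
  simp only [confParams, Finset.mem_union, mem_rootsInside, mem_rootsUpper, Finset.mem_insert,
    Finset.mem_singleton] at hz
  rcases hz with ⟨h, h1⟩ | ⟨h, h1, h2⟩ | rfl | rfl
  · exact ⟨ne_zero_of_mem_roots h, h1.le, fun h2 => absurd h2 h1.ne⟩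
  · exact ⟨ne_zero_of_mem_roots h, h1.le, fun _ => h2.le⟩
  · simp
  · simp

/-- Equal energies force `w = z` or `w = 1/z`. In the closed disk the latter puts both on the circle
with `w = conj z`, and then both imaginary parts, being nonnegative, vanish. -/
theorem energy_injOn : Set.InjOn (fun z : ℂ => z + z⁻¹) G.confParams := by
  intro z hz w hw h
  obtain ⟨hz0, hz1, hz2⟩ := mem_confParams hz
  obtain ⟨hw0, hw1, hw2⟩ := mem_confParams hw
  have key : (z - w) * (z * w - 1) = 0 := by
    simp only at h
    field_simp at h
    linear_combination h
  rcases mul_eq_zero.1 key with h | h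
  · exact sub_eq_zero.1 h
  · have hzw : z * w = 1 := sub_eq_zero.1 h
    have hn : ‖z‖ * ‖w‖ = 1 := by rw [← norm_mul, hzw, norm_one]
    have hz' : ‖z‖ = 1 := le_antisymm hz1 (by nlinarith [norm_nonneg z])
    have hw' : ‖w‖ = 1 := by rwa [hz', one_mul] at hn
    have hwz : w = conj z := by
      rw [← inv_eq_conj_of_norm_eq_one hz']
      exact eq_inv_of_mul_eq_one_right hzw
    have him : z.im = 0 := by
      refine le_antisymm ?_ (hz2 hz')
      have := hw2 hw'
      rw [hwz, Complex.conj_im] at this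
      linarith
    rw [hwz, Complex.conj_eq_iff_im.2 him]

/-- Only roots of `det γ` carry confined states, and a point of the lower half circle has the same
ones as its conjugate. -/
theorem iSup_confKernel :
    (⨆ z ∈ {z : ℂ | ‖z‖ < 1}, G.confKernel z) ⊔
        (⨆ z ∈ {z : ℂ | ‖z‖ = 1 ∧ z ≠ 1 ∧ z ≠ -1}, G.confKernel z) ⊔
      (⨆ z ∈ ({1, -1} : Set ℂ), G.confKernel z) = ⨆ z ∈ G.confParams, G.confKernel z := by
  have hle : ∀ z ∈ G.confParams, G.confKernel z ≤ ⨆ z ∈ G.confParams, G.confKernel z :=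
    fun z hz => le_iSup₂_of_le z hz le_rfl
  have hup : ∀ z, ‖z‖ = 1 → 0 < z.im →
      G.confKernel z ≤ ⨆ z ∈ G.confParams, G.confKernel z := fun z h1 h2 => by
    by_cases hz : z ∈ G.detGamma.roots
    · exact hle z (Finset.mem_union_right _ (Finset.mem_union_left _ (mem_rootsUpper.2 ⟨hz, h1, h2⟩)))
    · rw [confKernel_eq_bot hz]
      exact bot_le
  refine le_antisymm (sup_le (sup_le ?_ ?_) ?_) ?_
  · refine iSup₂_le fun z hz => ?_
    by_cases hr : z ∈ G.detGamma.roots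
    · exact hle z (Finset.mem_union_left _ (mem_rootsInside.2 ⟨hr, hz⟩))
    · rw [confKernel_eq_bot hr]
      exact bot_le
  · refine iSup₂_le fun z hz => ?_
    obtain ⟨h1, h2, h3⟩ := hz
    have hz0 : z ≠ 0 := by rintro rfl; simp at h1
    rcases lt_trichotomy z.im 0 with h | h | h
    · rw [← confKernel_inv hz0, inv_eq_conj_of_norm_eq_one h1]
      exact hup _ (by simpa using h1) (by simpa using h)
    · exact ((eq_one_or_neg_one_of_im_eq_zero h1 h).elim h2 h3).elim
    · exact hup z h1 h
  · refine iSup₂_le fun z hz => hle z ?_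
    refine Finset.mem_union_right _ (Finset.mem_union_right _ ?_)
    simpa using hz
  · refine iSup₂_le fun z hz => ?_
    simp only [confParams, Finset.mem_union, mem_rootsInside, mem_rootsUpper, Finset.mem_insert,
      Finset.mem_singleton] at hz
    rcases hz with ⟨-, h⟩ | ⟨-, h1, h2⟩ | h
    · exact le_sup_of_le_left (le_sup_of_le_left (le_iSup₂_of_le z h le_rfl))
    · refine le_sup_of_le_left (le_sup_of_le_right (le_iSup₂_of_le z ⟨h1, ?_, ?_⟩ le_rfl))
      · rintro rfl; simp at h2
      · rintro rfl; simp at h2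
    · exact le_sup_of_le_right (le_iSup₂_of_le z h le_rfl)

/-- The confined kernels lie in eigenspaces of `hamHat`, with distinct eigenvalues by
`energy_injOn`, so their sum is direct. -/
theorem numConfined_eq_sum :
    G.numConfined = ∑ z ∈ G.confParams, Module.finrank ℂ (G.confKernel z) := by
  rw [numConfined, confGT, confLT, confEQ, confinedSpan_eq_map, confinedSpan_eq_map,
    confinedSpan_eq_map, ← Submodule.map_sup, ← Submodule.map_sup, iSup_confKernel,
    GraphState.finrank_map_extend]
  refine Submodule.finrank_biSup_of_iSupIndep _ _ fun z hz t ht hzt => ?_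
  have heig : ∀ w ∈ G.confParams, G.confKernel w ≤
      Module.End.eigenspace G.hamHat.mulVecLin (w + w⁻¹) := fun w hw v hv => by
    rw [Module.End.mem_eigenspace_iff]
    exact hamHat_mulVec_of_mem_confKernel (mem_confParams hw).1 hv
  refine (Module.End.eigenspaces_iSupIndep G.hamHat.mulVecLin (z + z⁻¹)).mono (heig z hz)
    (iSup₂_le fun w hw => (heig w (ht hw)).trans ?_)
  refine le_iSup₂_of_le (w + w⁻¹) (fun h => hzt ?_) le_rfl
  rwa [← energy_injOn (ht hw) hz h]

theorem numConfined_eq :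
    G.numConfined = ∑ z ∈ G.rootsInside, Module.finrank ℂ (G.confKernel z) +
      (∑ z ∈ G.rootsUpper, Module.finrank ℂ (G.confKernel z) +
        (Module.finrank ℂ (G.confKernel 1) + Module.finrank ℂ (G.confKernel (-1)))) := by
  have h1 : Disjoint G.rootsUpper {1, -1} := by
    rw [Finset.disjoint_left]
    intro z hz h
    have := (mem_rootsUpper.1 hz).2.2
    simp only [Finset.mem_insert, Finset.mem_singleton] at h
    rcases h with rfl | rfl <;> simp at this
  have h2 : Disjoint G.rootsInside (G.rootsUpper ∪ {1, -1}) := by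
    rw [Finset.disjoint_left]
    intro z hz h
    have := (mem_rootsInside.1 hz).2
    simp only [Finset.mem_union, mem_rootsUpper, Finset.mem_insert, Finset.mem_singleton] at h
    rcases h with ⟨-, h, -⟩ | rfl | rfl
    · exact this.ne h
    · simp at this
    · simp at this
  rw [numConfined_eq_sum, confParams, Finset.sum_union h2, Finset.sum_union h1,
    Finset.sum_pair (by norm_num)]

theorem numUnconfined_eq :
    G.numUnconfined = ∑ z ∈ G.rootsInside, Module.finrank ℂ (G.unconfKernel z) := by
  have hreal : ∀ z ∈ G.rootsInside, ((z.re : ℝ) : ℂ) = z := fun z hz =>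
    Complex.ext rfl (im_eq_zero_of_mem_roots (mem_rootsInside.1 hz).1 (mem_rootsInside.1 hz).2).symm
  have hset : {x : ℝ | -1 < x ∧ x < 1 ∧ (G.gamma (x : ℂ)).det = 0} =
      ((G.rootsInside.image Complex.re : Finset ℝ) : Set ℝ) := by
    ext x
    simp only [Set.mem_ofPred_eq, Finset.coe_image, Set.mem_image, Finset.mem_coe]
    constructor
    · rintro ⟨h1, h2, h3⟩
      refine ⟨x, mem_rootsInside.2 ⟨?_, ?_⟩, Complex.ofReal_re x⟩
      · rwa [mem_roots G.detGamma_ne_zero, IsRoot, eval_detGamma]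
      · rw [Complex.norm_real, Real.norm_eq_abs]
        exact abs_lt.2 ⟨h1, h2⟩
    · rintro ⟨z, hz, rfl⟩
      have h := mem_rootsInside.1 hz
      have hn := h.2
      rw [← hreal z hz, Complex.norm_real, Real.norm_eq_abs, abs_lt] at hn
      refine ⟨hn.1, hn.2, ?_⟩
      rw [hreal z hz, ← eval_detGamma]
      exact (mem_roots G.detGamma_ne_zero).1 h.1
  rw [numUnconfined, hset, finsum_mem_coe_finset, Finset.sum_image fun z hz w hw h => by
    rw [← hreal z hz, ← hreal w hw, h]]
  refine Finset.sum_congr rfl fun z hz => ?_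
  rw [confGT, finrank_solutionSpace_inf_orth (by
    rw [hreal z hz]; exact (mem_rootsInside.1 hz).2), hreal z hz]

theorem numHalfBound_eq :
    G.numHalfBound =
      Module.finrank ℂ (G.unconfKernel 1) + Module.finrank ℂ (G.unconfKernel (-1)) := by
  have h1 := finrank_solutionSpace_inf_orth (G := G) (x := 1) (Z := {1, -1}) (by simp)
  have h2 := finrank_solutionSpace_inf_orth (G := G) (x := -1) (Z := {1, -1}) (by simp)
  rw [Complex.ofReal_one] at h1
  rw [Complex.ofReal_neg, Complex.ofReal_one] at h2
  rw [numHalfBound, confEQ, h1, h2]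

theorem countP_roots_inside : G.detGamma.roots.countP (‖·‖ < 1) =
    ∑ z ∈ G.rootsInside, Module.finrank ℂ (G.confKernel z) +
      ∑ z ∈ G.rootsInside, Module.finrank ℂ (G.unconfKernel z) := by
  rw [Multiset.countP_eq_sum_count, ← Finset.sum_add_distrib]
  refine Finset.sum_congr rfl fun z hz => ?_
  obtain ⟨hr, h1⟩ := mem_rootsInside.1 hz
  have hz : ((z.re : ℝ) : ℂ) = z := Complex.ext rfl (im_eq_zero_of_mem_roots hr h1).symm
  rw [count_roots]
  rw [← hz, Complex.norm_real, Real.norm_eq_abs] at h1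
  have := rootMultiplicity_of_abs_lt_one (G := G) (x := z.re)
    (by intro h; rw [h] at hz; exact ne_zero_of_mem_roots hr (by simpa using hz.symm)) h1
  rwa [hz] at this

/-- A nonreal confined energy accounts for two conjugate roots on the circle, whereas `numConfined`
counts it once; hence the factor 2. -/
theorem countP_roots_circle : G.detGamma.roots.countP (‖·‖ = 1) =
    2 * ∑ z ∈ G.rootsUpper, Module.finrank ℂ (G.confKernel z) +
      (2 * Module.finrank ℂ (G.confKernel 1) + Module.finrank ℂ (G.unconfKernel 1) +
        (2 * Module.finrank ℂ (G.confKernel (-1)) + Module.finrank ℂ (G.unconfKernel (-1)))) := by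
  have h1 := rootMultiplicity_of_sq_eq_one (G := G) (x := 1) (by simp)
  have h2 := rootMultiplicity_of_sq_eq_one (G := G) (x := -1) (by simp)
  rw [Complex.ofReal_one] at h1
  rw [Complex.ofReal_neg, Complex.ofReal_one] at h2
  have hdis : Disjoint G.rootsUpper (G.rootsUpper.image conj) := by
    rw [Finset.disjoint_left]
    intro z hz h
    obtain ⟨w, hw, rfl⟩ := Finset.mem_image.1 h
    have h3 := (mem_rootsUpper.1 hz).2.2
    have h4 := (mem_rootsUpper.1 hw).2.2
    rw [Complex.conj_im] at h3
    linarith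
  have hdis' : Disjoint (G.rootsUpper ∪ G.rootsUpper.image conj) {1, -1} := by
    rw [Finset.disjoint_right]
    intro z hz h
    simp only [Finset.mem_union, Finset.mem_image, mem_rootsUpper] at h
    have him : z.im = 0 := by
      simp only [Finset.mem_insert, Finset.mem_singleton] at hz
      rcases hz with rfl | rfl <;> simp
    rcases h with ⟨-, -, h⟩ | ⟨w, ⟨-, -, h⟩, rfl⟩
    · exact h.ne' him
    · rw [Complex.conj_im] at him
      linarith
  have hroot_conj : ∀ z, z ∈ G.detGamma.roots → conj z ∈ G.detGamma.roots := fun z hz => by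
    rw [← roots_detGamma_map_conj]
    exact Multiset.mem_map_of_mem _ hz
  have hsub : G.detGamma.roots.toFinset.filter (‖·‖ = 1) ⊆
      (G.rootsUpper ∪ G.rootsUpper.image conj) ∪ {1, -1} := by
    intro z hz
    obtain ⟨hr, hn⟩ := Finset.mem_filter.1 hz
    rw [Multiset.mem_toFinset] at hr
    rcases lt_trichotomy z.im 0 with h | h | h
    · refine Finset.mem_union_left _ (Finset.mem_union_right _ (Finset.mem_image.2
        ⟨conj z, mem_rootsUpper.2 ⟨hroot_conj z hr, ?_, ?_⟩, Complex.conj_conj z⟩))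
      · simpa using hn
      · simpa using h
    · refine Finset.mem_union_right _ ?_
      simpa using eq_one_or_neg_one_of_im_eq_zero hn h
    · exact Finset.mem_union_left _ (Finset.mem_union_left _ (mem_rootsUpper.2 ⟨hr, hn, h⟩))
  have hnorm : ∀ z ∈ (G.rootsUpper ∪ G.rootsUpper.image conj) ∪ {1, -1}, ‖z‖ = 1 := by
    intro z hz
    simp only [Finset.mem_union, Finset.mem_image, mem_rootsUpper, Finset.mem_insert,
      Finset.mem_singleton] at hz
    rcases hz with (⟨-, h, -⟩ | ⟨w, ⟨-, h, -⟩, rfl⟩) | rfl | rfl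
    · exact h
    · simpa using h
    · simp
    · simp
  have hupper : ∀ z ∈ G.rootsUpper,
      G.detGamma.rootMultiplicity z = Module.finrank ℂ (G.confKernel z) := fun z hz =>
    rootMultiplicity_of_im_ne_zero (mem_rootsUpper.1 hz).2.1 (mem_rootsUpper.1 hz).2.2.ne'
  have hlower : ∀ z ∈ G.rootsUpper,
      G.detGamma.rootMultiplicity (conj z) = Module.finrank ℂ (G.confKernel z) := fun z hz => by
    obtain ⟨hr, hn, him⟩ := mem_rootsUpper.1 hz
    rw [rootMultiplicity_of_im_ne_zero (by simpa using hn) (by simpa using him.ne'),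
      ← inv_eq_conj_of_norm_eq_one hn, confKernel_inv (ne_zero_of_mem_roots hr)]
  rw [Multiset.countP_eq_sum_count, Finset.sum_subset hsub, Finset.sum_union hdis',
    Finset.sum_union hdis, Finset.sum_image fun z _ w _ h => (starRingEnd ℂ).injective h,
    Finset.sum_pair (by norm_num)]
  · simp only [count_roots]
    rw [Finset.sum_congr rfl hupper, Finset.sum_congr rfl hlower, h1, h2]
    ring
  · intro z hz h
    rw [Multiset.count_eq_zero]
    intro hr
    exact h (Finset.mem_filter.2 ⟨Multiset.mem_toFinset.2 hr, hnorm z hz⟩)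

end

end ScatteringGraph

/-- Levinson's theorem for graphs. `RatFunc.eval` is the value of a rational function in lowest
terms, and `0` at its poles: that `HasCircleWindingNumber` holds includes that `det S` has neither
zeros nor poles on the unit circle. -/
theorem mainTheorem1 (n m : ℕ) (G : ScatteringGraph n m) :
    (∀ k : ℝ, -Real.pi < k → k < 0 → (G.gamma (Complex.exp (Complex.I * k))).det ≠ 0 →
      ∀ S₀ : Matrix (Fin n) (Fin n) ℂ,
        G.IsScatteringMatrix (Complex.exp (Complex.I * k)) S₀ ↔
          S₀ = G.sMatrix.map (RatFunc.eval (RingHom.id ℂ) (Complex.exp (Complex.I * k)))) ∧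
    ∃ w : ℤ,
      HasCircleWindingNumber (fun z => RatFunc.eval (RingHom.id ℂ) z G.sMatrix.det) w ∧
      (w : ℝ) = 2 * ((m : ℝ) - G.numUnconfined - G.numConfined - (G.numHalfBound : ℝ) / 2) := by
  refine ⟨fun k _ _ hd S₀ => ?_, _, ScatteringGraph.hasWinding_det_sMatrix.2, ?_⟩
  · rw [ScatteringGraph.sMatrix_map_eval (Complex.exp_ne_zero _) hd]
    exact ScatteringGraph.isScatteringMatrix_iff (Complex.exp_ne_zero _) hd S₀
  -- The weights agree: roots inside count twice, roots on the circle once but with confined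
  -- multiplicities already doubled.
  · rw [ScatteringGraph.countP_roots_inside, ScatteringGraph.countP_roots_circle,
      ScatteringGraph.numUnconfined_eq, ScatteringGraph.numConfined_eq,
      ScatteringGraph.numHalfBound_eq]
    push_cast
    ring
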